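/- Let $n\ge 2$ and $\mathfrak V=\{(i,j): 1\le j\le i\le n\}$. A (Gelfand–Tsetlin) tableau $T(L)$ is an array $L=(l_{ij})_{(i,j)\in\mathfrak V}$ of complex numbers; $(l_{ij})_j$ is its $i$-th row. Consider relations of three kinds: $(i,j)\ge(i-1,j')$; $(i-1,j')>(i,j)$; and $(n,i)\ge(n,j)$ with $i\ne j$. Let $\mathcal R$ be the set of all relations of the first two kinds and $\mathcal R^0$ that of the third kind. $T(L)$ satisfies $(i,j)\ge(s,t)$ (resp. $(i,j)>(s,t)$) if $l_{ij}-l_{st}\in\mathbb Z_{\ge0}$ (resp. $\mathbb Z_{>0}$), and it satisfies a set $\mathcal C\subseteq\mathcal R\cup\mathcal R^0$ if it satisfies all its elements. A tableau is noncritical if, in each row $k\le n-1$, its entries are pairwise distinct. Two relations are connected if they involve a common position; the classes of the equivalence relation generated by this are the indecomposable components of $\mathcal C$. A set $\mathcal D\subseteq\mathcal R$ is noncritical if, for each indecomposable component $\mathcal D'$ of $\mathcal D$, every tableau satisfying $\mathcal D'$ has $l_{ki}\neq l_{kj}$ whenever $k\le n-1$, $i\ne j$ and $(k,i),(k,j)$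 are both involved in $\mathcal D'$. A set $\mathcal C\subseteq\mathcal R\cup\mathcal R^0$ is noncritical if $\mathcal C\cap\mathcal R$ is noncritical, $\mathcal C\cap\mathcal R^0$ has no cycles, some tableau satisfies $\mathcal C$, and for each indecomposable component of $\mathcal C$ the relations in $\mathcal C\cap\mathcal R^0$ generate a total order on the positions of row $n$ involved in that component. For a tableau $T(L)$ satisfying $\mathcal C$, let $\mathcal B_{\mathcal C}(T(L))$ be the set of all tableaux $T(L+z)$ satisfying $\mathcal C$, with $z$ an integral array that vanishes on row $n$, and let $V_{\mathcal C}(T(L))$ be the complex vector space with basis $\mathcal B_{\mathcal C}(T(L))$. $T(L)$ is a $\mathcal C$-realization if it satisfies $\mathcal C$ and, for all $k\le n$ and $i\ne j$, $l_{ki}-l_{kj}\in\mathbb Z$ if and only if $(k,i)$ and $(k,j)$ are involved in the same indecomposable component of $\mathcal C$. The set $\mathcal C$ is admissible if for every $\mathcal C$-realization $T(L)$ all tableaux in $\mathcal B_{\mathcal C}(T(L))$ are noncritical and the Gelfand–Tsetlin formulas $$E_{k,k+1}T(R)=-\sum_{i=1}^{k}\frac{\prod_{j=1}^{k+1}(r_{ki}-r_{k+1,j})}{\prod_{j\ne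 i}(r_{ki}-r_{kj})}T(R+\delta^{ki}),\qquad E_{k+1,k}T(R)=\sum_{i=1}^{k}\frac{\prod_{j=1}^{k-1}(r_{ki}-r_{k-1,j})}{\prod_{j\ne i}(r_{ki}-r_{kj})}T(R-\delta^{ki}),$$ $$E_{kk}T(R)=\Big(k-1+\sum_{i=1}^k r_{ki}-\sum_{i=1}^{k-1}r_{k-1,i}\Big)T(R)$$ define a $\mathfrak{gl}_n$-module structure on $V_{\mathcal C}(T(L))$. Here $\delta^{ki}$ is the array with entry $1$ at $(k,i)$ and $0$ elsewhere, and a tableau outside $\mathcal B_{\mathcal C}(T(L))$ counts as $0$. **Proposition.** Let $\mathcal C\subseteq\mathcal R\cup\mathcal R^0$ be a noncritical admissible set of relations and $T(L)$ a $\mathcal C$-realization. Then the $\mathfrak{gl}_n$-module $V_{\mathcal C}(T(L))$ given by the Gelfand–Tsetlin formulas is irreducible if and only if $\mathcal C$ is the maximal set of relations satisfied by $T(L)$, in the following sense: whenever $T(L)$ satisfies a set $\mathcal C'\subseteq\mathcal R\cup\mathcal R^0$, every tableau in $\mathcal B_{\mathcal C}(T(L))$ satisfies $\mathcal C'$ as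 well. -/

import Mathlib

attribute [local instance] LieRing.ofAssociativeRing

/-- Positions of a Gelfand-Tsetlin tableau of height `n`. Rows are numbered from `0`: the row with
index `k` (written `k + 1` on paper) has `k + 1` entries, and the top row has index `n - 1`. -/
abbrev GTVertex (n : ℕ) : Type := (k : Fin n) × Fin ((k : ℕ) + 1)

/-- The row index (from `0`) of a position. -/
def GTVertex.row {n : ℕ} (v : GTVertex n) : ℕ := (v.1 : ℕ)

/-- A Gelfand-Tsetlin tableau `T(L)` of height `n` is its array `L` of complex entries. -/
abbrev GTTableau (n : ℕ) : Type := GTVertex n → ℂ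

/-- The relations that are considered:
* `down a b`: `a ≥ b`, where `b` lies in the row just below that of `a`;
* `up a b`: `a > b`, where `b` lies in the row just above that of `a`;
* `top a b`: `a ≥ b`, where `a ≠ b` both lie in the top row. -/
inductive GTRel (n : ℕ) : Type
  | down (a b : GTVertex n) (h : a.row = b.row + 1) : GTRel n
  | up (a b : GTVertex n) (h : b.row = a.row + 1) : GTRel n
  | top (a b : GTVertex n) (ha : a.row + 1 = n) (hb : b.row + 1 = n) (hne : a ≠ b) : GTRel n

namespace GTRel

variable {n : ℕ}

/-- The larger position of a relation. -/
def src : GTRel n → GTVertex n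
  | down a _ _ => a
  | up a _ _ => a
  | top a _ _ _ _ => a

/-- The smaller position of a relation. -/
def tgt : GTRel n → GTVertex n
  | down _ b _ => b
  | up _ b _ => b
  | top _ b _ _ _ => b

/-- The relations between two positions of the top row. -/
def IsTop : GTRel n → Prop
  | down _ _ _ => False
  | up _ _ _ => False
  | top _ _ _ _ _ => True

/-- `r.Holds L`: the tableau `T(L)` satisfies `r`, that is, the difference of the two entries is a
non-negative integer (for `≥`), respectively a positive integer (for `>`). -/
def Holds (L : GTTableau n) : GTRel n → Prop
  | down a b _ => ∃ m : ℕ, L a - L b = (m : ℂ)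
  | up a b _ => ∃ m : ℕ, L a - L b = (m : ℂ) + 1
  | top a b _ _ _ => ∃ m : ℕ, L a - L b = (m : ℂ)

end GTRel

namespace GTTableau

variable {n : ℕ}

/-- `T(L)` satisfies all relations in `C`. -/
def Satisfies (L : GTTableau n) (C : Set (GTRel n)) : Prop := ∀ r ∈ C, r.Holds L

/-- `T(L)` is noncritical: the entries of each row other than the top row are distinct. -/
def Noncritical (L : GTTableau n) : Prop :=
  ∀ a b : GTVertex n, a.row = b.row → a.row + 1 < n → a ≠ b → L a ≠ L b

/-- `R = L + z` for an integral vector `z` that vanishes on the top row. -/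
def IsShift (L R : GTTableau n) : Prop :=
  ∃ z : GTVertex n → ℤ, (∀ v, v.row + 1 = n → z v = 0) ∧ ∀ v, R v = L v + (z v : ℂ)

end GTTableau

namespace GT

variable {n : ℕ}

/-- The set `B_C(T(L))` of the tableaux `T(L + z)` that satisfy `C`. -/
def basisSet (C : Set (GTRel n)) (L : GTTableau n) : Set (GTTableau n) :=
  {R | GTTableau.IsShift L R ∧ GTTableau.Satisfies R C}

/-- The complex vector space `V_C(T(L))` with basis `B_C(T(L))`. -/
abbrev Space (C : Set (GTRel n)) (L : GTTableau n) : Type := ↥(basisSet C L) →₀ ℂ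

open Classical in
/-- The vector of `V_C(T(L))` given by a tableau `T(R)`, understood as `0` if `T(R)` is not in
`B_C(T(L))`. -/
noncomputable def vec (C : Set (GTRel n)) (L R : GTTableau n) : Space C L :=
  if h : R ∈ basisSet C L then Finsupp.single ⟨R, h⟩ 1 else 0

/-- The unit vector at the position `v`. -/
def delta (v : GTVertex n) : GTTableau n := Pi.single v 1

/-- The positions in the row with index `k`. -/
def rowSet (n k : ℕ) : Finset (GTVertex n) := Finset.univ.filter fun w => w.row = k

/-- The positions in the row just below the row with index `k` (none for `k = 0`). -/
def rowBelow (n k : ℕ) : Finset (GTVertex n) := Finset.univ.filter fun w => w.row + 1 = k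

/-- The coefficient of `T(L + δ^v)` in the formula for `E_{k,k+1} T(L)`. -/
noncomputable def eCoeff (L : GTTableau n) (v : GTVertex n) : ℂ :=
  -((∏ w ∈ rowSet n (v.row + 1), (L v - L w)) / ∏ w ∈ (rowSet n v.row).erase v, (L v - L w))

/-- The coefficient of `T(L - δ^v)` in the formula for `E_{k+1,k} T(L)`. -/
noncomputable def fCoeff (L : GTTableau n) (v : GTVertex n) : ℂ :=
  (∏ w ∈ rowBelow n v.row, (L v - L w)) / ∏ w ∈ (rowSet n v.row).erase v, (L v - L w)

/-- The eigenvalue of `E_{kk}` on `T(L)` (the index `k` starts from `0` here). -/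
noncomputable def hCoeff (L : GTTableau n) (k : ℕ) : ℂ :=
  (k : ℂ) + ∑ w ∈ rowSet n k, L w - ∑ w ∈ rowBelow n k, L w

/-- The given `gl_n`-module structure on `V_C(T(L))` is the one of the Gelfand-Tsetlin formulas, in
which a tableau outside `B_C(T(L))` counts as zero. -/
structure IsGTModule (C : Set (GTRel n)) (L : GTTableau n)
    [LieRingModule (Matrix (Fin n) (Fin n) ℂ) (Space C L)] : Prop where
  raise : ∀ k k' : Fin n, (k' : ℕ) = (k : ℕ) + 1 → ∀ R ∈ basisSet C L,
    ⁅(Matrix.single k k' 1 : Matrix (Fin n) (Fin n) ℂ), vec C L R⁆ =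
      ∑ v ∈ rowSet n k, eCoeff R v • vec C L (R + delta v)
  lower : ∀ k k' : Fin n, (k' : ℕ) = (k : ℕ) + 1 → ∀ R ∈ basisSet C L,
    ⁅(Matrix.single k' k 1 : Matrix (Fin n) (Fin n) ℂ), vec C L R⁆ =
      ∑ v ∈ rowSet n k, fCoeff R v • vec C L (R - delta v)
  diag : ∀ k : Fin n, ∀ R ∈ basisSet C L,
    ⁅(Matrix.single k k 1 : Matrix (Fin n) (Fin n) ℂ), vec C L R⁆ = hCoeff R k • vec C L R

/-- `C` contains a relation in which `a` is the larger and `b` the smaller position. -/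
def Edge (C : Set (GTRel n)) (a b : GTVertex n) : Prop := ∃ r ∈ C, r.src = a ∧ r.tgt = b

/-- `a = b`, or `a` and `b` are involved in the same indecomposable component of `C`. -/
def Linked (C : Set (GTRel n)) : GTVertex n → GTVertex n → Prop := Relation.EqvGen (Edge C)

/-- The indecomposable component of `C` in which the position `a` is involved (empty if there is
none). -/
def component (C : Set (GTRel n)) (a : GTVertex n) : Set (GTRel n) := {r ∈ C | Linked C a r.src}

/-- A set of relations between adjacent rows is noncritical if, for each of its indecomposable
components, every tableau that satisfies the component has distinct entries at those positions of
any one row, other than the top row, that are involved in the component. -/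
def NoncriticalLower (D : Set (GTRel n)) : Prop :=
  ∀ a b : GTVertex n, a ≠ b → a.row = b.row → a.row + 1 < n → Linked D a b →
    ∀ L : GTTableau n, L.Satisfies (component D a) → L a ≠ L b

/-- The relations of `C` between adjacent rows. -/
def lowerPart (C : Set (GTRel n)) : Set (GTRel n) := {r ∈ C | ¬ r.IsTop}

/-- The relations of `C` inside the top row. -/
def topPart (C : Set (GTRel n)) : Set (GTRel n) := {r ∈ C | r.IsTop}

/-- Noncritical sets of relations: the relations between adjacent rows form a noncritical set, the
relations inside the top row have no cycle, some tableau satisfies all relations, and the relations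
inside the top row order the top positions of each indecomposable component. -/
structure NoncriticalSet (C : Set (GTRel n)) : Prop where
  lower : NoncriticalLower (lowerPart C)
  acyclic : ∀ a : GTVertex n, ¬ Relation.TransGen (Edge (topPart C)) a a
  satisfiable : ∃ L : GTTableau n, L.Satisfies C
  order : ∀ a b : GTVertex n, a.row + 1 = n → b.row + 1 = n → a ≠ b → Linked C a b →
    Relation.TransGen (Edge (topPart C)) a b ∨ Relation.TransGen (Edge (topPart C)) b a

/-- `T(L)` is a `C`-realization: it satisfies `C`, and two entries of the same row differ by an
integer if and only if their positions are involved in the same indecomposable component. -/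
def IsRealization (C : Set (GTRel n)) (L : GTTableau n) : Prop :=
  L.Satisfies C ∧ ∀ a b : GTVertex n, a.row = b.row → a ≠ b →
    ((∃ m : ℤ, L a - L b = (m : ℂ)) ↔ Linked C a b)

/-- `C` is admissible: for every `C`-realization `T(L)` the Gelfand-Tsetlin formulas make sense on
`V_C(T(L))` (there is no critical tableau in `B_C(T(L))`) and define a `gl_n`-module. -/
def Admissible (C : Set (GTRel n)) : Prop :=
  ∀ L : GTTableau n, IsRealization C L →
    (∀ R ∈ basisSet C L, R.Noncritical) ∧
    ∃ (_ : LieRingModule (Matrix (Fin n) (Fin n) ℂ) (Space C L))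
      (_ : LieModule ℂ (Matrix (Fin n) (Fin n) ℂ) (Space C L)), IsGTModule C L

/-- `C` is the maximal set of relations satisfied by `T(L)`, up to equivalence on `B_C(T(L))`:
`T(L)` satisfies `C`, and for the tableaux `T(L + z)` the set `C` implies every set of relations
that `T(L)` satisfies. -/
def IsMaximalFor (C : Set (GTRel n)) (L : GTTableau n) : Prop :=
  L.Satisfies C ∧ ∀ C' : Set (GTRel n), L.Satisfies C' →
    ∀ R : GTTableau n, GTTableau.IsShift L R → R.Satisfies C → R.Satisfies C'

end GT

section Algebra

open Polynomial Finset

theorem degree_nodal_sub_nodal_lt {F ι κ : Type*} [Field F] (s : Finset ι) (v : ι → F)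
    (t : Finset κ) (u : κ → F) (h : #s = #t) :
    (Lagrange.nodal t u - Lagrange.nodal s v).degree < #s := by
  have h1 : (Lagrange.nodal t u).degree = (Lagrange.nodal s v).degree := by
    rw [Lagrange.degree_nodal, Lagrange.degree_nodal, h]
  have := degree_sub_lt_left h1 Lagrange.nodal_ne_zero
    (by rw [Lagrange.nodal_monic.leadingCoeff, Lagrange.nodal_monic.leadingCoeff])
  rwa [Lagrange.degree_nodal, ← h] at this

theorem coeff_nodal_sub_nodal {F ι κ : Type*} [Field F] (s : Finset ι) (v : ι → F)
    (t : Finset κ) (u : κ → F) (h : #s = #t) (hs : 0 < #s) :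
    (Lagrange.nodal t u - Lagrange.nodal s v).coeff (#s - 1) = ∑ i ∈ s, v i - ∑ i ∈ t, u i := by
  rw [coeff_sub, Lagrange.nodal_eq, Lagrange.nodal_eq, prod_X_sub_C_coeff_card_pred s v hs, h,
    prod_X_sub_C_coeff_card_pred t u (h ▸ hs)]
  ring

/-- The sum of the residues of a quotient of two monic polynomials of the same degree, the
denominator having simple roots. -/
theorem sum_prod_sub_div_prod_sub {F ι κ : Type*} [Field F] [DecidableEq ι] (s : Finset ι)
    (v : ι → F) (hv : Set.InjOn v s) (t : Finset κ) (u : κ → F) (h : #s = #t) (hs : 0 < #s) :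
    ∑ i ∈ s, (∏ k ∈ t, (v i - u k)) / ∏ j ∈ s.erase i, (v i - v j) =
      ∑ i ∈ s, v i - ∑ i ∈ t, u i := by
  rw [← coeff_nodal_sub_nodal s v t u h hs,
    Lagrange.coeff_eq_sum hv (degree_nodal_sub_nodal_lt s v t u h)]
  refine sum_congr rfl fun i hi => ?_
  rw [eval_sub, Lagrange.eval_nodal_at_node hi, sub_zero, Lagrange.eval_nodal]

theorem disjSum_erase_inl {α β : Type*} [DecidableEq α] [DecidableEq β]
    (s : Finset α) (t : Finset β) (a : α) :
    (s.disjSum t).erase (Sum.inl a) = (s.erase a).disjSum t := by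
  ext (x | x) <;> simp

theorem disjSum_erase_inr {α β : Type*} [DecidableEq α] [DecidableEq β]
    (s : Finset α) (t : Finset β) (b : β) :
    (s.disjSum t).erase (Sum.inr b) = s.disjSum (t.erase b) := by
  ext (x | x) <;> simp

/-- If `l v`, `l w = l v + 1` is the only pair of entries of a row with difference `1`, the
expected value of the commutator of the raising and lowering operators forces `l v` to be a double
zero of the numerator. -/
theorem double_zero_of_sum_eq {ι κ μ : Type*} [DecidableEq ι] [DecidableEq κ] [DecidableEq μ]
    (I : Finset ι) (l : ι → ℂ) (hl : Set.InjOn l I)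
    (U : Finset κ) (p : κ → ℂ) (hp : Set.InjOn p U)
    (D : Finset μ) (q : μ → ℂ) (hq : Set.InjOn q D)
    (hU : #U = #I + 1) (hD : #D + 1 = #I) {v w : ι} (hv : v ∈ I) (hw : w ∈ I) (hvw : l w = l v + 1)
    (huniq : ∀ i ∈ I, ∀ j ∈ I, l j = l i + 1 → i = v ∧ j = w)
    (hzero : (∃ c ∈ U, p c = l v) ∨ ∃ b ∈ D, q b = l v + 1)
    (hsum : ∑ i ∈ I, (-((∏ b ∈ D, (l i - q b)) * ∏ c ∈ U, (l i - 1 - p c)) /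
          ((∏ j ∈ I.erase i, (l i - l j)) * ∏ j ∈ I.erase i, (l i - 1 - l j))) -
        ∑ i ∈ I, (-((∏ c ∈ U, (l i - p c)) * ∏ b ∈ D, (l i + 1 - q b)) /
          ((∏ j ∈ I.erase i, (l i - l j)) * ∏ j ∈ I.erase i, (l i + 1 - l j))) =
      2 * ∑ i ∈ I, l i - ∑ c ∈ U, p c - ∑ b ∈ D, q b - 1) :
    (∃ c ∈ U, p c = l v) ∧ ∃ b ∈ D, q b = l v + 1 := by
  have hne : v ≠ w := by rintro rfl; simp at hvw
  set K := U.disjSum D with hK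
  set ρ : κ ⊕ μ → ℂ := Sum.elim p fun b => q b - 1 with hρ
  obtain ⟨k₀, hk₀, hρ₀⟩ : ∃ k ∈ K, ρ k = l v := by
    rcases hzero with ⟨c, hc, h⟩ | ⟨b, hb, h⟩
    · exact ⟨Sum.inl c, by simpa [hK] using hc, by simpa [hρ] using h⟩
    · exact ⟨Sum.inr b, by simpa [hK] using hb, by simp [hρ, h]⟩
  set s := I.disjSum (I.erase w) with hs
  set y : ι ⊕ ι → ℂ := Sum.elim l fun i => l i - 1 with hy
  have hKcard : #K = 2 * #I := by rw [hK, card_disjSum]; omega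
  have hIpos : 0 < #I := card_pos.2 ⟨v, hv⟩
  have hscard : #s = #(K.erase k₀) := by
    rw [hs, card_disjSum, card_erase_of_mem hw, card_erase_of_mem hk₀, hKcard]; omega
  have hspos : 0 < #s := by rw [hs, card_disjSum]; omega
  have hyinj : Set.InjOn y s := by
    rintro (i | i) hi (j | j) hj h <;> simp [hs, hy] at hi hj h ⊢
    · exact hl hi hj h
    · exact hj.1 (huniq i hi j hj.2 (by rw [h]; ring)).2
    · exact hi.1 (huniq j hj i hi.2 (by rw [← h]; ring)).2
    · exact hl hi.2 hj.2 h
  have hG : ∀ x, (∏ c ∈ U, (x - p c)) * ∏ b ∈ D, (x + 1 - q b) =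
      (x - l v) * ∏ k ∈ K.erase k₀, (x - ρ k) := by
    intro x
    rw [← hρ₀, mul_prod_erase K (fun k => x - ρ k) hk₀, hK, prod_disjSum]
    congr 1
    exact prod_congr rfl fun b _ => by simp only [hρ, Sum.elim_inr]; ring
  have key := sum_prod_sub_div_prod_sub s y hyinj (K.erase k₀) ρ hscard hspos
  set G₁ : ℂ → ℂ := fun x => ∏ k ∈ K.erase k₀, (x - ρ k) with hG₁
  have hup : ∀ i ∈ I.erase v, G₁ (l i) / ∏ j ∈ s.erase (Sum.inl i), (l i - y j) =
      -(-((∏ c ∈ U, (l i - p c)) * ∏ b ∈ D, (l i + 1 - q b)) /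
          ((∏ j ∈ I.erase i, (l i - l j)) * ∏ j ∈ I.erase i, (l i + 1 - l j))) := by
    intro i hi
    have hiI := mem_of_mem_erase hi
    have hiv := ne_of_mem_erase hi
    rw [hG, hs, disjSum_erase_inl, prod_disjSum]
    have h1 : ∏ j ∈ I.erase i, (l i + 1 - l j) = (l i - l v) * ∏ j ∈ I.erase w, (l i - y (Sum.inr j)) := by
      have e1 : ∏ j ∈ I, (l i + 1 - l j) = ∏ j ∈ I.erase i, (l i + 1 - l j) := by
        rw [← mul_prod_erase I _ hiI]; simp
      have e2 : ∏ j ∈ I, (l i + 1 - l j) = (l i - l v) * ∏ j ∈ I.erase w, (l i - y (Sum.inr j)) := by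
        rw [← mul_prod_erase I _ hw, hvw]
        congr 1
        · ring
        · exact prod_congr rfl fun b _ => by simp only [hy, Sum.elim_inr]; ring
      rw [← e1, e2]
    have h2 : l i - l v ≠ 0 := sub_ne_zero.2 fun h => hiv (hl hiI hv h)
    rw [h1, neg_div, neg_neg]
    simp only [hy, Sum.elim_inl, hG₁]
    rw [mul_left_comm, mul_div_mul_left _ _ h2]
  have hdn : ∀ i ∈ I.erase w, G₁ (l i - 1) / ∏ j ∈ s.erase (Sum.inr i), (l i - 1 - y j) =
      -((∏ b ∈ D, (l i - q b)) * ∏ c ∈ U, (l i - 1 - p c)) /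
          ((∏ j ∈ I.erase i, (l i - l j)) * ∏ j ∈ I.erase i, (l i - 1 - l j)) := by
    intro i hi
    have hiI := mem_of_mem_erase hi
    have hiw := ne_of_mem_erase hi
    have h0 := hG (l i - 1)
    rw [sub_add_cancel] at h0
    rw [mul_comm (∏ b ∈ D, (l i - q b)), h0, hs, disjSum_erase_inr, prod_disjSum]
    have h1 : ∏ j ∈ I.erase i, (l i - l j) = (l i - 1 - l v) *
        ∏ j ∈ (I.erase w).erase i, (l i - 1 - y (Sum.inr j)) := by
      rw [erase_right_comm, ← mul_prod_erase (I.erase i) _ (mem_erase.2 ⟨hiw.symm, hw⟩), hvw]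
      congr 1
      · ring
      · exact prod_congr rfl fun b _ => by simp only [hy, Sum.elim_inr]; ring
    have h3 : ∏ j ∈ I, (l i - 1 - y (Sum.inl j)) = - ∏ j ∈ I.erase i, (l i - 1 - l j) := by
      rw [← mul_prod_erase I _ hiI]
      simp [hy]
    have h2 : l i - 1 - l v ≠ 0 := by
      intro h
      refine hiw (hl hiI hw ?_)
      rw [hvw]; linear_combination h
    rw [h1, h3]
    simp only [hG₁]
    rw [mul_assoc, ← mul_neg, mul_div_mul_left _ _ h2, neg_mul, div_neg, neg_div, mul_comm]
  rw [hs, sum_disjSum, ← hs, ← add_sum_erase I _ hv] at key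
  have hzv : (-((∏ c ∈ U, (l v - p c)) * ∏ b ∈ D, (l v + 1 - q b)) /
          ((∏ j ∈ I.erase v, (l v - l j)) * ∏ j ∈ I.erase v, (l v + 1 - l j))) = 0 := by
    rw [prod_eq_zero (s := I.erase v) (f := fun j => l v + 1 - l j) (mem_erase.2 ⟨hne.symm, hw⟩)
      (by rw [hvw, sub_self]), mul_zero, div_zero]
  have hzw : -((∏ b ∈ D, (l w - q b)) * ∏ c ∈ U, (l w - 1 - p c)) /
          ((∏ j ∈ I.erase w, (l w - l j)) * ∏ j ∈ I.erase w, (l w - 1 - l j)) = 0 := by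
    rw [prod_eq_zero (s := I.erase w) (f := fun j => l w - 1 - l j) (mem_erase.2 ⟨hne, hv⟩)
      (by rw [hvw]; ring), mul_zero, div_zero]
  rw [← add_sum_erase I _ hw, hzw, zero_add, ← add_sum_erase I _ hv, hzv, zero_add] at hsum
  have e1 := sum_congr rfl hup
  have e2 := sum_congr rfl hdn
  simp only [hG₁] at e1 e2 key
  rw [sum_neg_distrib] at e1
  have hrhs : ∑ i ∈ s, y i - ∑ k ∈ K.erase k₀, ρ k =
      2 * ∑ i ∈ I, l i - ∑ c ∈ U, p c - ∑ b ∈ D, q b - 1 := by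
    have a1 : ∑ i ∈ s, y i = ∑ i ∈ I, l i + (∑ i ∈ I, l i - #I - l v) := by
      rw [hs, sum_disjSum]
      simp only [hy, Sum.elim_inl, Sum.elim_inr]
      have := add_sum_erase I (fun i => l i - 1) hw
      have h1 : ∑ i ∈ I, (l i - 1) = ∑ i ∈ I, l i - #I := by simp [sum_sub_distrib]
      rw [h1, hvw] at this
      linear_combination this
    have a2 : ∑ k ∈ K.erase k₀, ρ k = ∑ c ∈ U, p c + ∑ b ∈ D, q b - #D - l v := by
      have := add_sum_erase K ρ hk₀
      rw [hρ₀, hK, sum_disjSum, ← hK] at this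
      simp only [hρ, Sum.elim_inl, Sum.elim_inr, sum_sub_distrib, sum_const, nsmul_eq_mul,
        mul_one] at this ⊢
      linear_combination this
    have a3 : (#D : ℂ) + 1 = #I := by exact_mod_cast hD
    rw [a1, a2]
    linear_combination a3
  have hfin : G₁ (l v) / ∏ j ∈ s.erase (Sum.inl v), (l v - y j) = 0 := by
    rw [hrhs] at key
    simp only [hG₁]
    simp only [hy, Sum.elim_inl, Sum.elim_inr] at key e1 e2 ⊢
    rw [e1, e2] at key
    linear_combination key - hsum
  have hden : ∏ j ∈ s.erase (Sum.inl v), (l v - y j) ≠ 0 := by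
    rw [prod_ne_zero_iff]
    intro j hj h
    have hvs : Sum.inl v ∈ s := by simpa [hs] using hv
    exact ne_of_mem_erase hj (hyinj (mem_of_mem_erase hj) hvs
      (by simpa [hy] using (sub_eq_zero.1 h).symm))
  have hG0 : ∏ k ∈ K.erase k₀, (l v - ρ k) = 0 := (div_eq_zero_iff.1 hfin).resolve_right hden
  obtain ⟨k₁, hk₁, h⟩ := prod_eq_zero_iff.1 hG0
  have hρ₁ : ρ k₁ = l v := (sub_eq_zero.1 h).symm
  have hk₁K := mem_of_mem_erase hk₁
  have hk := ne_of_mem_erase hk₁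
  rcases k₀ with c | b <;> rcases k₁ with c' | b' <;>
    simp only [hK, hρ, Sum.elim_inl, Sum.elim_inr, inl_mem_disjSum, inr_mem_disjSum] at hk₀ hk₁K hρ₀ hρ₁
  · exact absurd (congrArg _ (hp hk₁K hk₀ (hρ₁.trans hρ₀.symm))) hk
  · exact ⟨⟨c, hk₀, hρ₀⟩, b', hk₁K, by linear_combination hρ₁⟩
  · exact ⟨⟨c', hk₁K, hρ₁⟩, b, hk₀, by linear_combination hρ₀⟩
  · exact absurd (congrArg _ (hq hk₁K hk₀ (by linear_combination hρ₁ - hρ₀))) hk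

end Algebra

namespace GTRel

variable {n : ℕ}

/-- The smallest difference of entries that is allowed by a relation. -/
def gap : GTRel n → ℕ
  | down _ _ _ => 0
  | up _ _ _ => 1
  | top _ _ _ _ _ => 0

theorem holds_iff (L : GTTableau n) (r : GTRel n) :
    r.Holds L ↔ ∃ m : ℕ, L r.src - L r.tgt = (m : ℂ) + r.gap := by
  cases r <;> simp [Holds, src, tgt, gap]

theorem holds_iff_int {L : GTTableau n} {r : GTRel n} {d : ℤ} (hd : L r.src - L r.tgt = d) :
    r.Holds L ↔ (r.gap : ℤ) ≤ d := by
  rw [holds_iff, hd]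
  constructor
  · rintro ⟨m, hm⟩
    have : d = m + r.gap := by exact_mod_cast hm
    omega
  · intro h
    obtain ⟨m, hm⟩ := Int.eq_ofNat_of_zero_le (sub_nonneg.2 h)
    refine ⟨m, ?_⟩
    have : d = m + r.gap := by omega
    exact_mod_cast this

theorem Holds.exists_int {L : GTTableau n} {r : GTRel n} (h : r.Holds L) :
    ∃ d : ℤ, L r.src - L r.tgt = d ∧ (r.gap : ℤ) ≤ d := by
  obtain ⟨m, hm⟩ := (holds_iff L r).1 h
  exact ⟨m + r.gap, by rw [hm]; push_cast; rfl, by omega⟩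

end GTRel

namespace GTTableau

variable {n : ℕ}

theorem IsShift.refl (L : GTTableau n) : IsShift L L := ⟨0, by simp, by simp⟩

theorem IsShift.symm {L R : GTTableau n} (h : IsShift L R) : IsShift R L := by
  obtain ⟨z, h0, hz⟩ := h
  exact ⟨-z, fun v hv => by simp [h0 v hv], fun v => by simp [hz]⟩

theorem IsShift.trans {L R S : GTTableau n} (h : IsShift L R) (h' : IsShift R S) :
    IsShift L S := by
  obtain ⟨z, h0, hz⟩ := h
  obtain ⟨z', h0', hz'⟩ := h'
  exact ⟨z + z', fun v hv => by simp [h0 v hv, h0' v hv],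
    fun v => by rw [hz', hz]; push_cast [Pi.add_apply]; ring⟩

theorem IsShift.exists_int {L R : GTTableau n} (h : IsShift L R) (v : GTVertex n) :
    ∃ d : ℤ, R v - L v = d := by
  obtain ⟨z, _, hz⟩ := h
  exact ⟨z v, by rw [hz]; ring⟩

theorem IsShift.eq_of_top {L R : GTTableau n} (h : IsShift L R) {v : GTVertex n}
    (hv : v.row + 1 = n) : R v = L v := by
  obtain ⟨z, h0, hz⟩ := h
  rw [hz, h0 v hv, Int.cast_zero, add_zero]

end GTTableau

namespace GT

variable {n : ℕ}

open GTTableau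

theorem delta_self (v : GTVertex n) : delta v v = 1 := Pi.single_eq_same _ _

theorem delta_of_ne {v w : GTVertex n} (h : w ≠ v) : delta v w = 0 := Pi.single_eq_of_ne h _

theorem delta_eq_intCast (v w : GTVertex n) : delta v w = ((Pi.single v 1 : GTVertex n → ℤ) w : ℂ) := by
  by_cases h : w = v
  · subst h; simp [delta_self]
  · simp [delta_of_ne h, h]

theorem delta_injective : Function.Injective (delta : GTVertex n → GTTableau n) := by
  intro v w h
  by_contra hne
  have := congrFun h v
  rw [delta_self, delta_of_ne hne] at this
  exact one_ne_zero this

theorem isShift_add_delta (R : GTTableau n) {v : GTVertex n} (hv : v.row + 1 < n) :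
    IsShift R (R + delta v) := by
  refine ⟨Pi.single v 1, fun w hw => Pi.single_eq_of_ne ?_ _, fun w => ?_⟩
  · rintro rfl; omega
  · rw [Pi.add_apply, delta_eq_intCast]

theorem isShift_sub_delta (R : GTTableau n) {v : GTVertex n} (hv : v.row + 1 < n) :
    IsShift R (R - delta v) := by
  have := isShift_add_delta (R - delta v) hv
  rw [sub_add_cancel] at this
  exact this.symm

theorem Linked.refl (C : Set (GTRel n)) (a : GTVertex n) : Linked C a a := Relation.EqvGen.refl a

theorem Linked.symm {C : Set (GTRel n)} {a b : GTVertex n} (h : Linked C a b) : Linked C b a :=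
  Relation.EqvGen.symm _ _ h

theorem Linked.trans {C : Set (GTRel n)} {a b c : GTVertex n} (h : Linked C a b)
    (h' : Linked C b c) : Linked C a c :=
  Relation.EqvGen.trans _ _ _ h h'

theorem linked_of_mem {C : Set (GTRel n)} {r : GTRel n} (h : r ∈ C) : Linked C r.src r.tgt :=
  Relation.EqvGen.rel _ _ ⟨r, h, rfl, rfl⟩

theorem exists_int_of_linked {C : Set (GTRel n)} {L : GTTableau n} (hL : L.Satisfies C)
    {a b : GTVertex n} (h : Linked C a b) : ∃ d : ℤ, L a - L b = d := by
  induction h with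
  | rel a b h =>
    obtain ⟨r, hr, rfl, rfl⟩ := h
    obtain ⟨d, hd, -⟩ := (hL r hr).exists_int
    exact ⟨d, hd⟩
  | refl a => exact ⟨0, by simp⟩
  | symm a b _ ih =>
    obtain ⟨d, hd⟩ := ih
    exact ⟨-d, by push_cast; rw [← hd]; ring⟩
  | trans a b c _ _ ih ih' =>
    obtain ⟨d, hd⟩ := ih
    obtain ⟨d', hd'⟩ := ih'
    exact ⟨d + d', by push_cast; rw [← hd, ← hd']; ring⟩

theorem exists_int_coordinate {C : Set (GTRel n)} {L : GTTableau n} (hL : L.Satisfies C) :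
    ∃ m : GTVertex n → ℤ, ∀ x y, Linked C x y → L x - L y = ((m x - m y : ℤ) : ℂ) := by
  let S := Relation.EqvGen.setoid (Edge C)
  have hb : ∀ x, Linked C x (Quotient.mk S x).out := fun x =>
    (Quotient.exact (Quotient.out_eq (Quotient.mk S x))).symm
  choose m hm using fun x => exists_int_of_linked hL (hb x)
  refine ⟨m, fun x y h => ?_⟩
  have hxy : Quotient.mk S x = Quotient.mk S y := Quotient.sound h
  have h1 := hm x
  rw [hxy] at h1
  push_cast
  rw [← h1, ← hm y]
  ring

theorem isRealization_of_int {C : Set (GTRel n)} {L M : GTTableau n} (hL : IsRealization C L)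
    (hM : M.Satisfies C) (h : ∀ v, ∃ d : ℤ, M v - L v = d) : IsRealization C M := by
  refine ⟨hM, fun a b hab hne => ?_⟩
  rw [← hL.2 a b hab hne]
  obtain ⟨d, hd⟩ := h a
  obtain ⟨e, he⟩ := h b
  constructor
  · rintro ⟨m, hm⟩
    exact ⟨m - d + e, by push_cast; rw [← hd, ← he, ← hm]; ring⟩
  · rintro ⟨m, hm⟩
    exact ⟨m + d - e, by push_cast; rw [← hd, ← he, ← hm]; ring⟩

theorem isRealization_of_mem {C : Set (GTRel n)} {L R : GTTableau n} (hL : IsRealization C L)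
    (hR : R ∈ basisSet C L) : IsRealization C R :=
  isRealization_of_int hL hR.2 hR.1.exists_int

theorem self_mem_basisSet {C : Set (GTRel n)} {L : GTTableau n} (hL : L.Satisfies C) :
    L ∈ basisSet C L := ⟨IsShift.refl L, hL⟩

theorem IsRealization.noncritical {C : Set (GTRel n)} {L : GTTableau n} (hadm : Admissible C)
    (hL : IsRealization C L) : L.Noncritical :=
  (hadm L hL).1 L (self_mem_basisSet hL.1)

/-- If the entry at `v` cannot be raised, it is blocked by an entry in an adjacent row. -/
theorem blocked_of_add_delta_notMem {C : Set (GTRel n)} {L R : GTTableau n} (hR : R ∈ basisSet C L)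
    {v : GTVertex n} (hv : v.row + 1 < n) (h : R + delta v ∉ basisSet C L) :
    (∃ c, c.row = v.row + 1 ∧ R c = R v ∧ ∃ r ∈ C, r.src = c ∧ r.tgt = v) ∨
      ∃ a, a.row + 1 = v.row ∧ R a = R v + 1 ∧ ∃ r ∈ C, r.src = a ∧ r.tgt = v := by
  have h' : ¬ (R + delta v).Satisfies C := fun hs => h ⟨hR.1.trans (isShift_add_delta R hv), hs⟩
  unfold Satisfies at h'
  push Not at h'
  obtain ⟨r, hr, hnot⟩ := h'
  obtain ⟨d, hd, hg⟩ := (hR.2 r hr).exists_int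
  have hd' : (R + delta v) r.src - (R + delta v) r.tgt =
      ((d + (Pi.single v 1 : GTVertex n → ℤ) r.src - (Pi.single v 1 : GTVertex n → ℤ) r.tgt : ℤ) : ℂ) := by
    push_cast
    rw [← delta_eq_intCast, ← delta_eq_intCast, ← hd, Pi.add_apply, Pi.add_apply]
    ring
  rw [GTRel.holds_iff_int hd'] at hnot
  have hs : (0 : ℤ) ≤ (Pi.single v 1 : GTVertex n → ℤ) r.src := by
    rw [Pi.single_apply]; split_ifs <;> norm_num
  have ht : r.tgt = v := by
    by_contra hne
    rw [Pi.single_eq_of_ne hne] at hnot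
    omega
  rw [ht, Pi.single_eq_same] at hnot
  have hdg : d = r.gap := by omega
  rw [ht, hdg, Int.cast_natCast] at hd
  rcases r with ⟨a, b, hab⟩ | ⟨a, b, hab⟩ | ⟨a, b, ha, hb, hab⟩
  · simp only [GTRel.src, GTRel.tgt, GTRel.gap] at ht hd
    subst ht
    exact Or.inl ⟨a, hab, by simpa [sub_eq_zero] using hd, _, hr, rfl, rfl⟩
  · simp only [GTRel.src, GTRel.tgt, GTRel.gap] at ht hd
    subst ht
    exact Or.inr ⟨a, hab.symm, by linear_combination (by simpa using hd : R a - R b = 1), _, hr, rfl, rfl⟩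
  · simp only [GTRel.tgt] at ht
    subst ht
    omega

/-- If the entry at `v` cannot be lowered, it is blocked by an entry in an adjacent row. -/
theorem blocked_of_sub_delta_notMem {C : Set (GTRel n)} {L R : GTTableau n} (hR : R ∈ basisSet C L)
    {v : GTVertex n} (hv : v.row + 1 < n) (h : R - delta v ∉ basisSet C L) :
    (∃ c, c.row = v.row + 1 ∧ R c = R v - 1 ∧ ∃ r ∈ C, r.src = v ∧ r.tgt = c) ∨
      ∃ a, a.row + 1 = v.row ∧ R a = R v ∧ ∃ r ∈ C, r.src = v ∧ r.tgt = a := by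
  have h' : ¬ (R - delta v).Satisfies C := fun hs => h ⟨hR.1.trans (isShift_sub_delta R hv), hs⟩
  unfold Satisfies at h'
  push Not at h'
  obtain ⟨r, hr, hnot⟩ := h'
  obtain ⟨d, hd, hg⟩ := (hR.2 r hr).exists_int
  have hd' : (R - delta v) r.src - (R - delta v) r.tgt =
      ((d - (Pi.single v 1 : GTVertex n → ℤ) r.src + (Pi.single v 1 : GTVertex n → ℤ) r.tgt : ℤ) : ℂ) := by
    push_cast
    rw [← delta_eq_intCast, ← delta_eq_intCast, ← hd, Pi.sub_apply, Pi.sub_apply]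
    ring
  rw [GTRel.holds_iff_int hd'] at hnot
  have hs : (0 : ℤ) ≤ (Pi.single v 1 : GTVertex n → ℤ) r.tgt := by
    rw [Pi.single_apply]; split_ifs <;> norm_num
  have ht : r.src = v := by
    by_contra hne
    rw [Pi.single_eq_of_ne hne] at hnot
    omega
  rw [ht, Pi.single_eq_same] at hnot
  have hdg : d = r.gap := by omega
  rw [ht, hdg, Int.cast_natCast] at hd
  rcases r with ⟨a, b, hab⟩ | ⟨a, b, hab⟩ | ⟨a, b, ha, hb, hab⟩
  · simp only [GTRel.src, GTRel.tgt, GTRel.gap] at ht hd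
    subst ht
    exact Or.inr ⟨b, hab.symm, (by simpa [sub_eq_zero] using hd : R a = R b).symm, _, hr, rfl, rfl⟩
  · simp only [GTRel.src, GTRel.tgt, GTRel.gap] at ht hd
    subst ht
    exact Or.inl ⟨b, hab, by linear_combination -(by simpa using hd : R a - R b = 1), _, hr, rfl, rfl⟩
  · simp only [GTRel.src] at ht
    subst ht
    omega

/-- The order of the entries of a row other than the top row is the same for all tableaux that
satisfy an admissible set. -/
theorem order_eq_of_mem {C : Set (GTRel n)} (hadm : Admissible C) {L R R' : GTTableau n}
    (hL : IsRealization C L) (hR : R ∈ basisSet C L) (hR' : R' ∈ basisSet C L) {a b : GTVertex n}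
    (hab : a.row = b.row) (ha : a.row + 1 < n) {d d' : ℤ} (hd : R a - R b = d)
    (hd' : R' a - R' b = d') (hpos : 0 < d) : 0 < d' := by
  classical
  have hRr := isRealization_of_mem hL hR
  have hne : a ≠ b := by
    rintro rfl
    rw [sub_self] at hd
    have : d = 0 := by exact_mod_cast hd.symm
    omega
  have hlink : Linked C a b := (hRr.2 a b hab hne).1 ⟨d, hd⟩
  have hd0 : d' ≠ 0 := by
    rintro rfl
    exact (isRealization_of_mem hL hR').noncritical hadm a b hab ha hne
      (sub_eq_zero.1 (by simpa using hd'))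
  by_contra hneg
  have hlt : d' < 0 := by omega
  let M : GTTableau n := fun x =>
    if Linked C a x then R a - d' * (R x - R a) + d * (R' x - R' a) else R x
  have hM : ∀ x, Linked C a x → M x = R a - d' * (R x - R a) + d * (R' x - R' a) :=
    fun x hx => if_pos hx
  have hM' : ∀ x, ¬ Linked C a x → M x = R x := fun x hx => if_neg hx
  have hsat : M.Satisfies C := by
    intro r hr
    have hl := linked_of_mem hr
    obtain ⟨e, he, hge⟩ := (hR.2 r hr).exists_int
    obtain ⟨e', he', hge'⟩ := (hR'.2 r hr).exists_int
    by_cases h : Linked C a r.src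
    · have : M r.src - M r.tgt = ((-d' * e + d * e' : ℤ) : ℂ) := by
        rw [hM _ h, hM _ (h.trans hl)]
        push_cast
        rw [← he, ← he']
        ring
      rw [GTRel.holds_iff_int this]
      have : 0 ≤ (r.gap : ℤ) := by positivity
      nlinarith
    · rw [GTRel.holds_iff_int (d := e)]
      · exact hge
      · rw [hM' _ h, hM' _ fun h' => h (h'.trans hl.symm), he]
  have hreal : IsRealization C M := by
    refine isRealization_of_int hRr hsat fun x => ?_
    by_cases h : Linked C a x
    · obtain ⟨e, he⟩ := exists_int_of_linked hR.2 h
      obtain ⟨e', he'⟩ := exists_int_of_linked hR'.2 h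
      refine ⟨e + d' * e - d * e', ?_⟩
      rw [hM _ h]
      push_cast
      rw [← he, ← he']
      ring
    · exact ⟨0, by rw [hM' _ h]; simp⟩
  refine hreal.noncritical hadm a b hab ha hne ?_
  rw [hM _ (Linked.refl C a), hM _ hlink]
  linear_combination (-d' : ℂ) * hd + (d : ℂ) * hd'

/-- Entries `l_v` and `l_w = l_v + 1` can be kept at distance `1`, while all other distances in the
row are made different from `1` and all other components are moved to other classes mod `ℤ`. -/
theorem exists_isRealization_spread {C : Set (GTRel n)} {L : GTTableau n} (hL : IsRealization C L)
    (v : GTVertex n) :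
    ∃ M : GTTableau n, IsRealization C M ∧
      (∀ c, M c = M v → L c = L v) ∧ (∀ c, M c = M v + 1 → L c = L v + 1) ∧
      (∀ w, Linked C v w → L w = L v + 1 → M w = M v + 1) ∧
      ∀ i j, i.row = j.row → M j = M i + 1 → L i = L v ∧ L j = L v + 1 := by
  classical
  obtain ⟨m, hm⟩ := exists_int_coordinate hL.1
  obtain ⟨s, hs⟩ : ∃ s : ℂ, ∀ (x y : GTVertex n) (d : ℤ), L x + s - L y ≠ d := by
    by_contra hcon
    push Not at hcon
    have hsur : Function.Surjective
        (fun p : GTVertex n × GTVertex n × ℤ => (p.2.2 : ℂ) + L p.2.1 - L p.1) := by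
      intro s
      obtain ⟨x, y, d, h⟩ := hcon s
      exact ⟨(x, y, d), by simp only; rw [← h]; ring⟩
    have : Countable ℂ := hsur.countable
    exact not_countable_complex Set.countable_univ
  set ε : GTVertex n → ℤ := fun x => if Linked C v x ∧ m v < m x then 1 else 0 with hε
  have hε01 : ∀ x, ε x = 0 ∨ ε x = 1 := fun x => by
    simp only [hε]; split_ifs <;> simp
  have hεmono : ∀ x y, Linked C x y → m x ≤ m y → ε x ≤ ε y := by
    intro x y hxy hle
    by_cases hx : Linked C v x ∧ m v < m x
    · have hy : Linked C v y ∧ m v < m y := ⟨hx.1.trans hxy, hx.2.trans_le hle⟩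
      simp [hε, hx, hy]
    · have : ε x = 0 := if_neg hx
      rcases hε01 y with h | h <;> omega
  have hεv : ε v = 0 := by simp [hε]
  let M : GTTableau n := fun x => L x + ((m x - ε x : ℤ) : ℂ) + if Linked C v x then 0 else s
  have hM1 : ∀ x, Linked C v x → M x = L x + ((m x - ε x : ℤ) : ℂ) := fun x hx => by
    simp [M, hx]
  have hM2 : ∀ x, ¬ Linked C v x → M x = L x + ((m x - ε x : ℤ) : ℂ) + s := fun x hx => by
    simp [M, hx]
  have hdiff : ∀ x y, Linked C x y → M x - M y = ((2 * (m x - m y) - (ε x - ε y) : ℤ) : ℂ) := by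
    intro x y hxy
    have h1 := hm x y hxy
    push_cast at h1 ⊢
    by_cases hx : Linked C v x
    · rw [hM1 x hx, hM1 y (hx.trans hxy)]
      push_cast
      linear_combination h1
    · rw [hM2 x hx, hM2 y fun h => hx (h.trans hxy.symm)]
      push_cast
      linear_combination h1
  have hgen : ∀ x y, Linked C v x → ¬ Linked C v y → ∀ d : ℤ, M x - M y ≠ d := by
    intro x y hx hy d h
    rw [hM1 x hx, hM2 y hy] at h
    refine hs y x (-d + (m x - ε x) - (m y - ε y)) ?_
    push_cast at h ⊢
    linear_combination -h
  have hsat : M.Satisfies C := by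
    intro r hr
    have hl := linked_of_mem hr
    obtain ⟨d, hd, hg⟩ := (hL.1 r hr).exists_int
    have hd' : m r.src - m r.tgt = d := by
      have := hm _ _ hl
      rw [hd] at this
      exact_mod_cast this.symm
    rw [GTRel.holds_iff_int (hdiff _ _ hl)]
    have h0 : 0 ≤ (r.gap : ℤ) := by positivity
    rcases hε01 r.src with h1 | h1 <;> rcases hε01 r.tgt with h2 | h2
    · omega
    · omega
    · rcases eq_or_ne d 0 with h3 | h3
      · have := hεmono _ _ hl (by omega)
        omega
      · omega
    · omega
  have hreal : IsRealization C M := by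
    refine ⟨hsat, fun a b hab hne => ⟨?_, fun h => ⟨_, hdiff a b h⟩⟩⟩
    rintro ⟨d, hd⟩
    by_cases ha : Linked C v a
    · by_cases hb : Linked C v b
      · exact ha.symm.trans hb
      · exact absurd hd (hgen a b ha hb d)
    · by_cases hb : Linked C v b
      · refine absurd ?_ (hgen b a hb ha (-d))
        push_cast
        rw [← hd]
        ring
      · rw [← hL.2 a b hab hne]
        rw [hM2 a ha, hM2 b hb] at hd
        refine ⟨d - (m a - ε a) + (m b - ε b), ?_⟩
        push_cast at hd ⊢
        linear_combination hd
  have hlv : ∀ c (d : ℤ), M c - M v = d → Linked C v c := by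
    intro c d h
    by_contra hc
    refine hgen v c (Linked.refl C v) hc (-d) ?_
    push_cast
    rw [← h]
    ring
  refine ⟨M, hreal, fun c hc => ?_, fun c hc => ?_, fun w hw h => ?_, fun i j hij h => ?_⟩
  · have hl := hlv c 0 (by simp [hc])
    have h1 := hdiff c v hl.symm
    rw [hc, sub_self] at h1
    have h2 : 0 = 2 * (m c - m v) - (ε c - ε v) := by exact_mod_cast h1
    have h3 : m c - m v = 0 := by rcases hε01 c with h | h <;> omega
    have h4 := hm c v hl.symm
    rw [h3, Int.cast_zero] at h4
    exact sub_eq_zero.1 h4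
  · have hl := hlv c 1 (by simp [hc])
    have h1 := hdiff c v hl.symm
    rw [hc, add_sub_cancel_left] at h1
    have h2 : 1 = 2 * (m c - m v) - (ε c - ε v) := by exact_mod_cast h1
    have h3 : m c - m v = 1 := by rcases hε01 c with h | h <;> omega
    have h4 := hm c v hl.symm
    rw [h3, Int.cast_one] at h4
    linear_combination h4
  · have h1 := hm w v hw.symm
    rw [h, add_sub_cancel_left] at h1
    have h2 : 1 = m w - m v := by exact_mod_cast h1
    have h3 : ε w = 1 := if_pos ⟨hw, by omega⟩
    have h4 := hdiff w v hw.symm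
    rw [h3, hεv, ← h2] at h4
    norm_num at h4
    linear_combination h4
  · have hne : i ≠ j := by
      rintro rfl
      simp at h
    have hl : Linked C j i := ((hreal.2 j i hij.symm hne.symm).1 ⟨1, by simp [h]⟩)
    have h1 := hdiff j i hl
    rw [h, add_sub_cancel_left] at h1
    have h2 : 1 = 2 * (m j - m i) - (ε j - ε i) := by exact_mod_cast h1
    have h3 : m j - m i = 1 ∧ ε j = 1 ∧ ε i = 0 := by
      rcases hε01 j with h4 | h4 <;> rcases hε01 i with h5 | h5
      · omega
      · have := hεmono i j hl.symm (by omega)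
        omega
      · omega
      · omega
    obtain ⟨h3, h4, h5⟩ := h3
    have h6 : Linked C v j ∧ m v < m j := by
      by_contra hcon
      rw [hε] at h4
      simp [hcon] at h4
    have h7 : ¬ m v < m i := by
      intro hcon
      have : ε i = 1 := if_pos ⟨h6.1.trans hl, hcon⟩
      omega
    have h8 := hm j v h6.1.symm
    have h9 := hm i v (h6.1.trans hl).symm
    rw [show m j - m v = 1 by omega, Int.cast_one] at h8
    rw [show m i - m v = 0 by omega, Int.cast_zero] at h9
    exact ⟨sub_eq_zero.1 h9, by linear_combination h8⟩

end GT

namespace GT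

variable {n : ℕ}

open GTTableau

theorem mem_rowSet {k : ℕ} {v : GTVertex n} : v ∈ rowSet n k ↔ v.row = k := by simp [rowSet]

theorem mem_rowBelow {k : ℕ} {v : GTVertex n} : v ∈ rowBelow n k ↔ v.row + 1 = k := by
  simp [rowBelow]

theorem card_rowSet {k : ℕ} (hk : k < n) : (rowSet n k).card = k + 1 := by
  have : rowSet n k = Finset.univ.map
      ⟨fun j : Fin (k + 1) => (⟨⟨k, hk⟩, j⟩ : GTVertex n), fun i j h => by simpa using h⟩ := by
    ext ⟨⟨i, hi⟩, j⟩
    simp only [mem_rowSet, GTVertex.row, Finset.mem_map, Finset.mem_univ, true_and]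
    constructor
    · rintro rfl
      exact ⟨j, rfl⟩
    · rintro ⟨j, h⟩
      have := congrArg (fun v : GTVertex n => (v.1 : ℕ)) h
      exact this.symm
  rw [this, Finset.card_map, Finset.card_univ, Fintype.card_fin]

theorem rowBelow_succ (k : ℕ) : rowBelow n (k + 1) = rowSet n k := by
  ext v; simp [mem_rowBelow, mem_rowSet]

theorem rowBelow_zero : rowBelow n 0 = ∅ := by
  ext v; simp [mem_rowBelow]

theorem card_rowBelow {k : ℕ} (hk : k ≤ n) : (rowBelow n k).card = k := by
  cases k with
  | zero => rw [rowBelow_zero, Finset.card_empty]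
  | succ k => rw [rowBelow_succ, card_rowSet hk]

/-- The eigenvalue on `T(R)` of the component of `E_{k+1,k} E_{k,k+1}` that raises and lowers the
entry at `v`. -/
noncomputable def feCoeff (R : GTTableau n) (v : GTVertex n) : ℂ :=
  -((∏ w ∈ rowSet n (v.row + 1), (R v - R w)) * ∏ w ∈ rowBelow n v.row, (R v + 1 - R w)) /
    ((∏ w ∈ (rowSet n v.row).erase v, (R v - R w)) *
      ∏ w ∈ (rowSet n v.row).erase v, (R v + 1 - R w))

/-- The eigenvalue on `T(R)` of the component of `E_{k,k+1} E_{k+1,k}` that lowers and raises the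
entry at `v`. -/
noncomputable def efCoeff (R : GTTableau n) (v : GTVertex n) : ℂ :=
  -((∏ w ∈ rowBelow n v.row, (R v - R w)) * ∏ w ∈ rowSet n (v.row + 1), (R v - 1 - R w)) /
    ((∏ w ∈ (rowSet n v.row).erase v, (R v - R w)) *
      ∏ w ∈ (rowSet n v.row).erase v, (R v - 1 - R w))

theorem fCoeff_add_delta (R : GTTableau n) (v : GTVertex n) :
    fCoeff (R + delta v) v = (∏ w ∈ rowBelow n v.row, (R v + 1 - R w)) /
      ∏ w ∈ (rowSet n v.row).erase v, (R v + 1 - R w) := by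
  unfold fCoeff
  congr 1
  · refine Finset.prod_congr rfl fun w hw => ?_
    have : w ≠ v := by rintro rfl; rw [mem_rowBelow] at hw; omega
    simp [delta_self, delta_of_ne this]
  · refine Finset.prod_congr rfl fun w hw => ?_
    simp [delta_self, delta_of_ne (Finset.ne_of_mem_erase hw)]

theorem eCoeff_sub_delta (R : GTTableau n) (v : GTVertex n) :
    eCoeff (R - delta v) v = -((∏ w ∈ rowSet n (v.row + 1), (R v - 1 - R w)) /
      ∏ w ∈ (rowSet n v.row).erase v, (R v - 1 - R w)) := by
  unfold eCoeff
  congr 2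
  · refine Finset.prod_congr rfl fun w hw => ?_
    have : w ≠ v := by rintro rfl; rw [mem_rowSet] at hw; omega
    simp [delta_self, delta_of_ne this]
  · refine Finset.prod_congr rfl fun w hw => ?_
    simp [delta_self, delta_of_ne (Finset.ne_of_mem_erase hw)]

theorem eCoeff_mul_fCoeff (R : GTTableau n) (v : GTVertex n) :
    eCoeff R v * fCoeff (R + delta v) v = feCoeff R v := by
  rw [fCoeff_add_delta, eCoeff, feCoeff, neg_mul, div_mul_div_comm, neg_div]

theorem fCoeff_mul_eCoeff (R : GTTableau n) (v : GTVertex n) :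
    fCoeff R v * eCoeff (R - delta v) v = efCoeff R v := by
  rw [eCoeff_sub_delta, fCoeff, efCoeff, mul_neg, div_mul_div_comm, neg_div]

theorem feCoeff_eq_zero_of_notMem {C : Set (GTRel n)} {L R : GTTableau n} (hR : R ∈ basisSet C L)
    {v : GTVertex n} (hv : v.row + 1 < n) (h : R + delta v ∉ basisSet C L) : feCoeff R v = 0 := by
  unfold feCoeff
  rcases blocked_of_add_delta_notMem hR hv h with ⟨c, hc, h, -⟩ | ⟨a, ha, h, -⟩
  · rw [Finset.prod_eq_zero (mem_rowSet.2 hc) (by rw [h, sub_self]), zero_mul, neg_zero, zero_div]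
  · rw [Finset.prod_eq_zero (s := rowBelow n v.row) (mem_rowBelow.2 ha) (by rw [h, sub_self]),
      mul_zero, neg_zero, zero_div]

theorem efCoeff_eq_zero_of_notMem {C : Set (GTRel n)} {L R : GTTableau n} (hR : R ∈ basisSet C L)
    {v : GTVertex n} (hv : v.row + 1 < n) (h : R - delta v ∉ basisSet C L) : efCoeff R v = 0 := by
  unfold efCoeff
  rcases blocked_of_sub_delta_notMem hR hv h with ⟨c, hc, h, -⟩ | ⟨a, ha, h, -⟩
  · rw [Finset.prod_eq_zero (s := rowSet n (v.row + 1)) (mem_rowSet.2 hc) (by rw [h, sub_self]),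
      mul_zero, neg_zero, zero_div]
  · rw [Finset.prod_eq_zero (mem_rowBelow.2 ha) (by rw [h, sub_self]), zero_mul, neg_zero, zero_div]

theorem vec_of_mem {C : Set (GTRel n)} {L R : GTTableau n} (hR : R ∈ basisSet C L) :
    vec C L R = Finsupp.single ⟨R, hR⟩ 1 := dif_pos hR

theorem vec_of_notMem {C : Set (GTRel n)} {L R : GTTableau n} (hR : R ∉ basisSet C L) :
    vec C L R = 0 := dif_neg hR

open Classical in
theorem vec_apply {C : Set (GTRel n)} {L : GTTableau n} (S : GTTableau n) (R : basisSet C L) :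
    vec C L S R = if S = R then 1 else 0 := by
  by_cases hS : S ∈ basisSet C L
  · rw [vec_of_mem hS, Finsupp.single_apply]
    simp [Subtype.ext_iff]
  · rw [vec_of_notMem hS, if_neg]
    · rfl
    · rintro rfl
      exact hS R.2

/-- Two tableaux agree in the rows with index less than `k`. -/
def AgreeBelow (k : ℕ) (R S : GTTableau n) : Prop := ∀ v : GTVertex n, v.row < k → R v = S v

theorem AgreeBelow.refl (k : ℕ) (R : GTTableau n) : AgreeBelow k R R := fun _ _ => rfl

theorem AgreeBelow.symm {k : ℕ} {R S : GTTableau n} (h : AgreeBelow k R S) : AgreeBelow k S R :=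
  fun v hv => (h v hv).symm

theorem AgreeBelow.trans {k : ℕ} {R S T : GTTableau n} (h : AgreeBelow k R S)
    (h' : AgreeBelow k S T) : AgreeBelow k R T := fun v hv => (h v hv).trans (h' v hv)

theorem AgreeBelow.mono {k l : ℕ} {R S : GTTableau n} (h : AgreeBelow k R S) (hl : l ≤ k) :
    AgreeBelow l R S := fun v hv => h v (hv.trans_le hl)

theorem agreeBelow_add_delta {k : ℕ} {R S : GTTableau n} (h : AgreeBelow k R S) {u v : GTVertex n}
    (hu : u.row < k) : AgreeBelow k (R + delta u) (S + delta v) ↔ u = v := by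
  constructor
  · intro h'
    by_contra hne
    have := h' u hu
    rw [Pi.add_apply, Pi.add_apply, h u hu, delta_self, delta_of_ne hne] at this
    simp at this
  · rintro rfl w hw
    rw [Pi.add_apply, Pi.add_apply, h w hw]

theorem agreeBelow_sub_delta {k : ℕ} {R S : GTTableau n} (h : AgreeBelow k R S) {u v : GTVertex n}
    (hu : u.row < k) : AgreeBelow k (R - delta u) (S - delta v) ↔ u = v := by
  constructor
  · intro h'
    by_contra hne
    have := h' u hu
    rw [Pi.sub_apply, Pi.sub_apply, h u hu, delta_self, delta_of_ne hne] at this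
    simp at this
  · rintro rfl w hw
    rw [Pi.sub_apply, Pi.sub_apply, h w hw]

open Classical in
/-- The projection of `V_C(T(L))` to the span of the tableaux with a given property. -/
noncomputable def proj (C : Set (GTRel n)) (L : GTTableau n) (p : GTTableau n → Prop) :
    Space C L →ₗ[ℂ] Space C L where
  toFun x := x.filter fun R => p R
  map_add' _ _ := Finsupp.filter_add
  map_smul' _ _ := Finsupp.filter_smul

open Classical in
theorem proj_apply {C : Set (GTRel n)} {L : GTTableau n} (p : GTTableau n → Prop) (x : Space C L)
    (R : basisSet C L) : proj C L p x R = if p R then x R else 0 :=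
  Finsupp.filter_apply _ _ _

open Classical in
theorem proj_vec {C : Set (GTRel n)} {L : GTTableau n} (p : GTTableau n → Prop) (R : GTTableau n) :
    proj C L p (vec C L R) = if p R then vec C L R else 0 := by
  ext S
  rw [proj_apply]
  by_cases hRS : R = S
  · rw [hRS]
    split_ifs <;> rfl
  · rw [vec_apply, if_neg hRS, ite_self]
    split_ifs
    · rw [vec_apply, if_neg hRS]
    · rfl

section Module

variable {C : Set (GTRel n)} {L : GTTableau n}
  [LieRingModule (Matrix (Fin n) (Fin n) ℂ) (Space C L)]
  [LieModule ℂ (Matrix (Fin n) (Fin n) ℂ) (Space C L)]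

theorem lie_sum_smul_vec (x : Matrix (Fin n) (Fin n) ℂ) (s : Finset (GTVertex n))
    (c : GTVertex n → ℂ) (f : GTVertex n → GTTableau n) :
    ⁅x, ∑ u ∈ s, c u • vec C L (f u)⁆ = ∑ u ∈ s, c u • ⁅x, vec C L (f u)⁆ := by
  rw [lie_sum]
  exact Finset.sum_congr rfl fun u _ => lie_smul _ _ _

theorem lower_raise_apply (hGT : IsGTModule C L) {k k' : Fin n} (hk : (k' : ℕ) = k + 1)
    (R : basisSet C L) :
    ⁅(Matrix.single k' k 1 : Matrix (Fin n) (Fin n) ℂ),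
      ⁅(Matrix.single k k' 1 : Matrix (Fin n) (Fin n) ℂ), vec C L R⁆⁆ R =
      ∑ v ∈ rowSet n k, feCoeff (R : GTTableau n) v := by
  rw [hGT.raise k k' hk R R.2, lie_sum_smul_vec, Finsupp.finsetSum_apply]
  refine Finset.sum_congr rfl fun u hu => ?_
  rw [Finsupp.smul_apply, smul_eq_mul]
  have hu' : u.row + 1 < n := by rw [mem_rowSet.1 hu]; omega
  by_cases hm : (R : GTTableau n) + delta u ∈ basisSet C L
  · rw [hGT.lower k k' hk _ hm, Finsupp.finsetSum_apply, Finset.sum_eq_single u,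
      Finsupp.smul_apply, vec_apply, if_pos (add_sub_cancel_right _ _), smul_eq_mul, mul_one,
      eCoeff_mul_fCoeff]
    · intro w _ hw
      rw [Finsupp.smul_apply, vec_apply, if_neg, smul_zero]
      intro h
      rw [add_sub_assoc, add_eq_left, sub_eq_zero] at h
      exact hw (delta_injective h).symm
    · exact fun h => absurd hu h
  · rw [vec_of_notMem hm, lie_zero, Finsupp.zero_apply, mul_zero,
      feCoeff_eq_zero_of_notMem R.2 hu' hm]

theorem raise_lower_apply (hGT : IsGTModule C L) {k k' : Fin n} (hk : (k' : ℕ) = k + 1)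
    (R : basisSet C L) :
    ⁅(Matrix.single k k' 1 : Matrix (Fin n) (Fin n) ℂ),
      ⁅(Matrix.single k' k 1 : Matrix (Fin n) (Fin n) ℂ), vec C L R⁆⁆ R =
      ∑ v ∈ rowSet n k, efCoeff (R : GTTableau n) v := by
  rw [hGT.lower k k' hk R R.2, lie_sum_smul_vec, Finsupp.finsetSum_apply]
  refine Finset.sum_congr rfl fun u hu => ?_
  rw [Finsupp.smul_apply, smul_eq_mul]
  have hu' : u.row + 1 < n := by rw [mem_rowSet.1 hu]; omega
  by_cases hm : (R : GTTableau n) - delta u ∈ basisSet C L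
  · rw [hGT.raise k k' hk _ hm, Finsupp.finsetSum_apply, Finset.sum_eq_single u,
      Finsupp.smul_apply, vec_apply, if_pos (sub_add_cancel _ _), smul_eq_mul, mul_one,
      fCoeff_mul_eCoeff]
    · intro w _ hw
      rw [Finsupp.smul_apply, vec_apply, if_neg, smul_zero]
      intro h
      rw [sub_add_eq_add_sub, add_sub_assoc, add_eq_left, sub_eq_zero] at h
      exact hw (delta_injective h)
    · exact fun h => absurd hu h
  · rw [vec_of_notMem hm, lie_zero, Finsupp.zero_apply, mul_zero,
      efCoeff_eq_zero_of_notMem R.2 hu' hm]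

theorem sum_efCoeff_sub_sum_feCoeff (hGT : IsGTModule C L) {k : ℕ} (hk : k + 1 < n)
    (R : basisSet C L) :
    ∑ v ∈ rowSet n k, efCoeff (R : GTTableau n) v - ∑ v ∈ rowSet n k, feCoeff (R : GTTableau n) v =
      hCoeff (R : GTTableau n) k - hCoeff (R : GTTableau n) (k + 1) := by
  set i : Fin n := ⟨k, by omega⟩ with hi
  set j : Fin n := ⟨k + 1, hk⟩ with hj
  have hij : (j : ℕ) = i + 1 := rfl
  have h : ⁅(Matrix.single i j 1 : Matrix (Fin n) (Fin n) ℂ),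
      (Matrix.single j i 1 : Matrix (Fin n) (Fin n) ℂ)⁆ =
      Matrix.single i i 1 - Matrix.single j j 1 := by
    rw [Ring.lie_def, Matrix.single_mul_single_same, Matrix.single_mul_single_same, mul_one]
  have h1 := lie_lie (Matrix.single i j 1 : Matrix (Fin n) (Fin n) ℂ) (Matrix.single j i 1)
    (vec C L R)
  rw [h, sub_lie, hGT.diag i R R.2, hGT.diag j R R.2] at h1
  have h2 := DFunLike.congr_fun h1 R
  rw [Finsupp.sub_apply, Finsupp.sub_apply, raise_lower_apply hGT hij, lower_raise_apply hGT hij,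
    Finsupp.smul_apply, Finsupp.smul_apply, vec_apply, if_pos rfl, smul_eq_mul, smul_eq_mul,
    mul_one, mul_one] at h2
  exact h2.symm

theorem proj_lower_proj_raise (hGT : IsGTModule C L) {k k' : Fin n} (hk : (k' : ℕ) = k + 1)
    {u : GTVertex n} (hu : u.row = k) {l : ℕ} (hl : (k : ℕ) < l) {R S : GTTableau n}
    (hR : R ∈ basisSet C L) (hRS : AgreeBelow l R S) :
    proj C L (AgreeBelow l · S) ⁅(Matrix.single k' k 1 : Matrix (Fin n) (Fin n) ℂ),
      proj C L (AgreeBelow l · (S + delta u))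
        ⁅(Matrix.single k k' 1 : Matrix (Fin n) (Fin n) ℂ), vec C L R⁆⁆ =
      feCoeff R u • vec C L R := by
  have hur : u ∈ rowSet n k := mem_rowSet.2 hu
  have hu' : u.row + 1 < n := by rw [hu]; omega
  rw [hGT.raise k k' hk R hR, map_sum, Finset.sum_eq_single u]
  · rw [map_smul, proj_vec, if_pos ((agreeBelow_add_delta hRS (hu ▸ hl)).2 rfl), lie_smul, map_smul]
    by_cases hm : R + delta u ∈ basisSet C L
    · rw [hGT.lower k k' hk _ hm, map_sum, Finset.sum_eq_single u]
      · rw [map_smul, add_sub_cancel_right, proj_vec, if_pos hRS, smul_smul, eCoeff_mul_fCoeff]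
      · intro w hw hne
        rw [map_smul, proj_vec, if_neg, smul_zero]
        intro h
        have h1 := (agreeBelow_add_delta hRS (hu ▸ hl)).2 (rfl : u = u)
        have h2 : AgreeBelow l (R + delta u - delta w) (S + delta u - delta u) := by
          rwa [add_sub_cancel_right]
        rw [agreeBelow_sub_delta h1 (by rw [mem_rowSet.1 hw]; exact hl)] at h2
        exact hne h2
      · exact fun h => absurd hur h
    · rw [vec_of_notMem hm, lie_zero, map_zero, smul_zero, feCoeff_eq_zero_of_notMem hR hu' hm,
        zero_smul]
  · intro w hw hne
    rw [map_smul, proj_vec, if_neg, smul_zero]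
    rwa [agreeBelow_add_delta hRS (by rw [mem_rowSet.1 hw]; exact hl)]
  · exact fun h => absurd hur h

theorem proj_raise_proj_lower (hGT : IsGTModule C L) {k k' : Fin n} (hk : (k' : ℕ) = k + 1)
    {u : GTVertex n} (hu : u.row = k) {l : ℕ} (hl : (k : ℕ) < l) {R S : GTTableau n}
    (hR : R ∈ basisSet C L) (hRS : AgreeBelow l R S) :
    proj C L (AgreeBelow l · S) ⁅(Matrix.single k k' 1 : Matrix (Fin n) (Fin n) ℂ),
      proj C L (AgreeBelow l · (S - delta u))
        ⁅(Matrix.single k' k 1 : Matrix (Fin n) (Fin n) ℂ), vec C L R⁆⁆ =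
      efCoeff R u • vec C L R := by
  have hur : u ∈ rowSet n k := mem_rowSet.2 hu
  have hu' : u.row + 1 < n := by rw [hu]; omega
  rw [hGT.lower k k' hk R hR, map_sum, Finset.sum_eq_single u]
  · rw [map_smul, proj_vec, if_pos ((agreeBelow_sub_delta hRS (hu ▸ hl)).2 rfl), lie_smul, map_smul]
    by_cases hm : R - delta u ∈ basisSet C L
    · rw [hGT.raise k k' hk _ hm, map_sum, Finset.sum_eq_single u]
      · rw [map_smul, sub_add_cancel, proj_vec, if_pos hRS, smul_smul, fCoeff_mul_eCoeff]
      · intro w hw hne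
        rw [map_smul, proj_vec, if_neg, smul_zero]
        intro h
        have h1 := (agreeBelow_sub_delta hRS (hu ▸ hl)).2 (rfl : u = u)
        have h2 : AgreeBelow l (R - delta u + delta w) (S - delta u + delta u) := by
          rwa [sub_add_cancel]
        rw [agreeBelow_add_delta h1 (by rw [mem_rowSet.1 hw]; exact hl)] at h2
        exact hne h2
      · exact fun h => absurd hur h
    · rw [vec_of_notMem hm, lie_zero, map_zero, smul_zero, efCoeff_eq_zero_of_notMem hR hu' hm,
        zero_smul]
  · intro w hw hne
    rw [map_smul, proj_vec, if_neg, smul_zero]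
    rwa [agreeBelow_sub_delta hRS (by rw [mem_rowSet.1 hw]; exact hl)]
  · exact fun h => absurd hur h

end Module

theorem exists_blocking_of_unique {C : Set (GTRel n)} (hadm : Admissible C) {M : GTTableau n}
    (hM : IsRealization C M) {v w : GTVertex n} (hvw : v.row = w.row) (hv : v.row + 2 < n)
    (h : M w = M v + 1)
    (huniq : ∀ i j : GTVertex n, i.row = v.row → j.row = v.row → M j = M i + 1 → i = v ∧ j = w) :
    (∃ c, c.row = v.row + 1 ∧ M c = M v) ∧ ∃ a, a.row + 1 = v.row ∧ M a = M v + 1 := by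
  obtain ⟨hnc, _, _, hGT⟩ := hadm M hM
  have hMB := self_mem_basisSet hM.1
  have hinj : ∀ k, k + 1 < n → Set.InjOn M (rowSet n k) := by
    intro k hk a ha b hb hab
    by_contra hne
    have ha' := mem_rowSet.1 ha
    have hb' := mem_rowSet.1 hb
    exact hnc M hMB a b (ha'.trans hb'.symm) (by omega) hne hab
  have hinj' : Set.InjOn M (rowBelow n v.row) := by
    intro a ha b hb hab
    have ha' := mem_rowBelow.1 ha
    have hb' := mem_rowBelow.1 hb
    exact hinj a.row (by omega) (mem_rowSet.2 rfl) (mem_rowSet.2 (by omega)) hab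
  have hne : v ≠ w := by
    rintro rfl
    simp at h
  have hadd : M + delta v ∉ basisSet C M := by
    intro hmem
    refine hnc _ hmem v w hvw (by omega) hne ?_
    rw [Pi.add_apply, Pi.add_apply, delta_self, delta_of_ne hne.symm, h, add_zero]
  have key := double_zero_of_sum_eq (rowSet n v.row) M (hinj _ (by omega))
    (rowSet n (v.row + 1)) M (hinj _ (by omega)) (rowBelow n v.row) M hinj'
    (by rw [card_rowSet (by omega), card_rowSet (by omega)])
    (by rw [card_rowSet (by omega), card_rowBelow (by omega)])
    (mem_rowSet.2 rfl) (mem_rowSet.2 hvw.symm) h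
    (fun i hi j hj => huniq i j (mem_rowSet.1 hi) (mem_rowSet.1 hj)) ?_ ?_
  · simpa only [mem_rowSet, mem_rowBelow] using key
  · rcases blocked_of_add_delta_notMem hMB (by omega) hadd with ⟨c, hc, h, -⟩ | ⟨a, ha, h, -⟩
    · exact Or.inl ⟨c, mem_rowSet.2 hc, h⟩
    · exact Or.inr ⟨a, mem_rowBelow.2 ha, h⟩
  · have := sum_efCoeff_sub_sum_feCoeff hGT (k := v.row) (by omega) ⟨M, hMB⟩
    simp only [hCoeff, rowBelow_succ] at this
    have e1 : ∑ i ∈ rowSet n v.row, (-((∏ b ∈ rowBelow n v.row, (M i - M b)) *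
        ∏ c ∈ rowSet n (v.row + 1), (M i - 1 - M c)) /
          ((∏ j ∈ (rowSet n v.row).erase i, (M i - M j)) *
            ∏ j ∈ (rowSet n v.row).erase i, (M i - 1 - M j))) = ∑ i ∈ rowSet n v.row, efCoeff M i :=
      Finset.sum_congr rfl fun i hi => by rw [efCoeff, mem_rowSet.1 hi]
    have e2 : ∑ i ∈ rowSet n v.row, (-((∏ c ∈ rowSet n (v.row + 1), (M i - M c)) *
        ∏ b ∈ rowBelow n v.row, (M i + 1 - M b)) /
          ((∏ j ∈ (rowSet n v.row).erase i, (M i - M j)) *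
            ∏ j ∈ (rowSet n v.row).erase i, (M i + 1 - M j))) = ∑ i ∈ rowSet n v.row, feCoeff M i :=
      Finset.sum_congr rfl fun i hi => by rw [feCoeff, mem_rowSet.1 hi]
    rw [e1, e2, this]
    push_cast
    ring

/-- Two entries of a row with difference `1` are separated by an entry in the row above and by one
in the row below. -/
theorem exists_blocking {C : Set (GTRel n)} (hadm : Admissible C) {L : GTTableau n}
    (hL : IsRealization C L) {v w : GTVertex n} (hvw : v.row = w.row) (hv : v.row + 2 < n)
    (h : L w = L v + 1) :
    (∃ c, c.row = v.row + 1 ∧ L c = L v) ∧ ∃ a, a.row + 1 = v.row ∧ L a = L v + 1 := by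
  obtain ⟨M, hM, h0, h1, h2, h3⟩ := exists_isRealization_spread hL v
  have hnc := hL.noncritical hadm
  have hne : v ≠ w := by
    rintro rfl
    simp at h
  have hl : Linked C v w := (hL.2 v w hvw hne).1 ⟨-1, by rw [h]; push_cast; ring⟩
  obtain ⟨⟨c, hc, hc'⟩, a, ha, ha'⟩ := exists_blocking_of_unique hadm hM hvw hv (h2 w hl h) (by
    intro i j hi hj hij
    obtain ⟨h4, h5⟩ := h3 i j (hi.trans hj.symm) hij
    constructor
    · by_contra hiv
      exact hnc i v hi (by omega) hiv h4
    · by_contra hjw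
      exact hnc j w (hj.trans hvw) (by omega) hjw (h5.trans h.symm))
  exact ⟨⟨c, hc, h0 c hc'⟩, a, ha, h1 a ha'⟩

end GT

section DiagonalOperators

variable {X : Type*}

/-- The diagonal operator with eigenvalues `g`. -/
noncomputable def diagOp (g : X → ℂ) : (X →₀ ℂ) →ₗ[ℂ] (X →₀ ℂ) where
  toFun x := Finsupp.onFinset x.support (fun r => g r * x r) fun r h => by
    rw [Finsupp.mem_support_iff]
    exact right_ne_zero_of_mul h
  map_add' x y := by ext r; simp [mul_add]
  map_smul' c x := by ext r; simp; ring

theorem diagOp_apply (g : X → ℂ) (x : X →₀ ℂ) (r : X) : diagOp g x r = g r * x r := rfl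

theorem eq_diagOp_of_single (Φ : (X →₀ ℂ) →ₗ[ℂ] (X →₀ ℂ)) (g : X → ℂ) (x : X →₀ ℂ)
    (h : ∀ r ∈ x.support, Φ (Finsupp.single r 1) = g r • Finsupp.single r 1) :
    Φ x = diagOp g x := by
  have hx : x = ∑ r ∈ x.support, x r • Finsupp.single r (1 : ℂ) := by
    conv_lhs => rw [← Finsupp.sum_single x]
    simp [Finsupp.sum]
  have hd : ∀ r, diagOp g (Finsupp.single r 1) = g r • Finsupp.single r 1 := by
    intro r
    ext s
    rw [diagOp_apply, Finsupp.smul_apply, smul_eq_mul]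
    by_cases hrs : r = s
    · rw [hrs]
    · rw [Finsupp.single_eq_of_ne' hrs, mul_zero, mul_zero]
  rw [hx, map_sum, map_sum]
  refine Finset.sum_congr rfl fun r hr => ?_
  rw [map_smul, map_smul, hd, h r hr]

open Classical in
/-- A subspace that is stable under diagonal operators separating the points of a set from all other
points contains the restrictions of its elements to that set. -/
theorem filter_mem_of_separating (W : Submodule ℂ (X →₀ ℂ)) (p : X → Prop) (r : X)
    (hsep : ∀ x ∈ W, ∀ s ∈ x.support, ¬ p s → ∃ g : X → ℂ, (∀ y ∈ W, diagOp g y ∈ W) ∧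
      (∀ t, p t → g t = g r) ∧ g s ≠ g r) (x : X →₀ ℂ) (hx : x ∈ W) : x.filter p ∈ W := by
  induction hN : (x.support.filter fun s => ¬ p s).card using Nat.strong_induction_on
    generalizing x with
  | _ N ih =>
    by_cases hall : ∀ s ∈ x.support, p s
    · rwa [(Finsupp.filter_eq_self_iff p x).2 fun s hs => hall s (Finsupp.mem_support_iff.2 hs)]
    · push Not at hall
      obtain ⟨s, hs, hps⟩ := hall
      obtain ⟨g, hg, hconst, hne⟩ := hsep x hx s hs hps
      set y : X →₀ ℂ := (g r - g s)⁻¹ • (diagOp g x - g s • x) with hy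
      have hyW : y ∈ W := W.smul_mem _ (W.sub_mem (hg x hx) (W.smul_mem _ hx))
      have hyt : ∀ t, y t = (g r - g s)⁻¹ * ((g t - g s) * x t) := by
        intro t
        rw [hy, Finsupp.smul_apply, Finsupp.sub_apply, diagOp_apply, Finsupp.smul_apply]
        simp only [smul_eq_mul]
        ring
      have hfil : y.filter p = x.filter p := by
        ext t
        rw [Finsupp.filter_apply, Finsupp.filter_apply]
        split_ifs with ht
        · rw [hyt, hconst t ht, inv_mul_cancel_left₀ (sub_ne_zero.2 hne.symm)]
        · rfl
      rw [← hfil]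
      refine ih _ ?_ y hyW rfl
      rw [← hN]
      refine Finset.card_lt_card ⟨?_, fun h => ?_⟩
      · intro t ht
        rw [Finset.mem_filter, Finsupp.mem_support_iff] at ht ⊢
        refine ⟨fun h0 => ht.1 ?_, ht.2⟩
        rw [hyt, h0, mul_zero, mul_zero]
      · have := h (Finset.mem_filter.2 ⟨hs, hps⟩)
        rw [Finset.mem_filter, Finsupp.mem_support_iff] at this
        refine this.1 ?_
        rw [hyt, sub_self, zero_mul, mul_zero]

end DiagonalOperators

namespace GT

variable {n : ℕ}

open GTTableau Polynomial

theorem feCoeff_congr {R R' : GTTableau n} {v : GTVertex n} (h : AgreeBelow (v.row + 2) R R') :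
    feCoeff R v = feCoeff R' v := by
  have h0 : R v = R' v := h v (by omega)
  have h1 : ∀ w ∈ rowSet n (v.row + 1), R w = R' w := fun w hw =>
    h w (by rw [mem_rowSet.1 hw]; omega)
  have h2 : ∀ w ∈ rowBelow n v.row, R w = R' w := fun w hw =>
    h w (by have := mem_rowBelow.1 hw; omega)
  have h3 : ∀ w ∈ (rowSet n v.row).erase v, R w = R' w := fun w hw =>
    h w (by rw [mem_rowSet.1 (Finset.mem_of_mem_erase hw)]; omega)
  unfold feCoeff
  rw [h0, Finset.prod_congr rfl fun w hw => by rw [h1 w hw],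
    Finset.prod_congr (s₁ := rowBelow n v.row) rfl fun w hw => by rw [h2 w hw],
    Finset.prod_congr (s₁ := (rowSet n v.row).erase v) (f := fun w => R' v - R w) rfl
      fun w hw => by rw [h3 w hw],
    Finset.prod_congr (s₁ := (rowSet n v.row).erase v) (f := fun w => R' v + 1 - R w) rfl
      fun w hw => by rw [h3 w hw]]

theorem efCoeff_congr {R R' : GTTableau n} {v : GTVertex n} (h : AgreeBelow (v.row + 2) R R') :
    efCoeff R v = efCoeff R' v := by
  have h0 : R v = R' v := h v (by omega)
  have h1 : ∀ w ∈ rowSet n (v.row + 1), R w = R' w := fun w hw =>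
    h w (by rw [mem_rowSet.1 hw]; omega)
  have h2 : ∀ w ∈ rowBelow n v.row, R w = R' w := fun w hw =>
    h w (by have := mem_rowBelow.1 hw; omega)
  have h3 : ∀ w ∈ (rowSet n v.row).erase v, R w = R' w := fun w hw =>
    h w (by rw [mem_rowSet.1 (Finset.mem_of_mem_erase hw)]; omega)
  unfold efCoeff
  rw [h0, Finset.prod_congr rfl fun w hw => by rw [h2 w hw],
    Finset.prod_congr (s₁ := rowSet n (v.row + 1)) rfl fun w hw => by rw [h1 w hw],
    Finset.prod_congr (s₁ := (rowSet n v.row).erase v) (f := fun w => R' v - R w) rfl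
      fun w hw => by rw [h3 w hw],
    Finset.prod_congr (s₁ := (rowSet n v.row).erase v) (f := fun w => R' v - 1 - R w) rfl
      fun w hw => by rw [h3 w hw]]

theorem hCoeff_congr {R R' : GTTableau n} {k : ℕ} (h : AgreeBelow (k + 1) R R') :
    hCoeff R k = hCoeff R' k := by
  unfold hCoeff
  rw [Finset.sum_congr rfl fun w hw => h w (by rw [mem_rowSet.1 hw]; omega),
    Finset.sum_congr (s₁ := rowBelow n k) rfl
      fun w hw => h w (by have := mem_rowBelow.1 hw; omega)]

theorem false_of_max_of_ne {C : Set (GTRel n)} (hadm : Admissible C) {L R R' : GTTableau n}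
    (hL : IsRealization C L) (hR : R ∈ basisSet C L) (hR' : R' ∈ basisSet C L) {w u : GTVertex n}
    (hw : w.row + 1 < n) (hu : u.row = w.row) (hne : R w ≠ R' w) (huw : R' u = R w)
    (hmax : ∀ u, u.row = w.row → R u ≠ R' u → (R u).re ≤ (R w).re)
    (hmax' : (R' w).re ≤ (R w).re) : False := by
  have hnc := (isRealization_of_mem hL hR).noncritical hadm
  have hne' : u ≠ w := by
    rintro rfl
    exact hne huw.symm
  have hRu : R u ≠ R w := hnc u w hu (by omega) hne'
  have hub : R u ≠ R' u := by rwa [huw]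
  obtain ⟨d, hd⟩ := (hR.1.symm.trans hR'.1).exists_int u
  rw [huw] at hd
  obtain ⟨e, he⟩ := (hR'.1.symm.trans hR.1).exists_int w
  have hd0 : 0 < d := by
    have h1 := hmax u hu hub
    have h2 := congrArg Complex.re hd
    rw [Complex.sub_re, Complex.intCast_re] at h2
    have h3 : (0 : ℝ) ≤ d := by linarith
    have h4 : d ≠ 0 := by
      rintro rfl
      exact hRu (sub_eq_zero.1 (by simpa using hd)).symm
    have h5 : 0 ≤ d := by exact_mod_cast h3
    omega
  have he' : R' w - R' u = ((-e : ℤ) : ℂ) := by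
    rw [huw]
    push_cast
    rw [← he]
    ring
  have h1 := order_eq_of_mem hadm hL hR hR' hu.symm hw hd he' hd0
  have h2 := congrArg Complex.re he
  rw [Complex.sub_re, Complex.intCast_re] at h2
  have h3 : (0 : ℝ) ≤ e := by linarith
  have h4 : 0 ≤ e := by exact_mod_cast h3
  omega

/-- A row of a tableau of `V_C(T(L))` other than the top row is determined by its set of entries. -/
theorem agree_row_of_image_eq {C : Set (GTRel n)} (hadm : Admissible C) {L R R' : GTTableau n}
    (hL : IsRealization C L) (hR : R ∈ basisSet C L) (hR' : R' ∈ basisSet C L) {k : ℕ}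
    (hk : k + 1 < n) (h : ∀ w : GTVertex n, w.row = k → ∃ u : GTVertex n, u.row = k ∧ R' u = R w)
    (h' : ∀ w : GTVertex n, w.row = k → ∃ u : GTVertex n, u.row = k ∧ R u = R' w)
    (w : GTVertex n) (hw : w.row = k) : R w = R' w := by
  classical
  by_contra hne
  obtain ⟨w, hw, hmax⟩ := Finset.exists_max_image
    ((rowSet n k).filter fun w => R w ≠ R' w) (fun w => max (R w).re (R' w).re)
    ⟨w, Finset.mem_filter.2 ⟨mem_rowSet.2 hw, hne⟩⟩
  rw [Finset.mem_filter, mem_rowSet] at hw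
  obtain ⟨hw, hne⟩ := hw
  have hmax' : ∀ u : GTVertex n, u.row = w.row → R u ≠ R' u →
      max (R u).re (R' u).re ≤ max (R w).re (R' w).re :=
    fun u hu hu' => hmax u (Finset.mem_filter.2 ⟨mem_rowSet.2 (hu.trans hw), hu'⟩)
  rcases le_total (R' w).re (R w).re with hle | hle
  · obtain ⟨u, hu, huw⟩ := h w hw
    rw [max_eq_left hle] at hmax'
    exact false_of_max_of_ne hadm hL hR hR' (by omega) (hu.trans hw.symm) hne huw
      (fun u hu hu' => (le_max_left _ _).trans (hmax' u hu hu')) hle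
  · obtain ⟨u, hu, huw⟩ := h' w hw
    rw [max_eq_right hle] at hmax'
    exact false_of_max_of_ne hadm hL hR' hR (by omega) (hu.trans hw.symm) hne.symm huw
      (fun u hu hu' => (le_max_right _ _).trans (hmax' u hu hu'.symm)) hle

theorem degree_nodal_sub_lt {R R' : GTTableau n} {k : ℕ} (hk : k < n)
    (h : ∑ w ∈ rowSet n k, R w = ∑ w ∈ rowSet n k, R' w) :
    (Lagrange.nodal (rowSet n k) R - Lagrange.nodal (rowSet n k) R').degree < (k : ℕ) := by
  have hc := card_rowSet hk
  have h1 := degree_nodal_sub_nodal_lt (rowSet n k) R' (rowSet n k) R rfl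
  have h2 := coeff_nodal_sub_nodal (rowSet n k) R' (rowSet n k) R rfl (by omega)
  rw [h, sub_self, hc, Nat.add_sub_cancel] at h2
  rw [hc] at h1
  rw [Polynomial.degree_lt_iff_coeff_zero] at h1 ⊢
  intro m hm
  rcases Nat.eq_or_lt_of_le hm with rfl | hm
  · exact h2
  · exact h1 m hm

/-- The row sums and the eigenvalues of the components of `E_{k+1,k} E_{k,k+1}` and
`E_{k,k+1} E_{k+1,k}` separate the tableaux that differ in a row but agree below it. -/
theorem agreeBelow_succ_of_coeff_eq {C : Set (GTRel n)} (hadm : Admissible C)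
    {L R R' : GTTableau n} (hL : IsRealization C L) (hR : R ∈ basisSet C L)
    (hR' : R' ∈ basisSet C L) {k : ℕ} (hk : k + 1 < n) (hag : AgreeBelow k R R')
    (hh : hCoeff R k = hCoeff R' k)
    (hfe : ∀ v : GTVertex n, v.row + 1 = k → feCoeff R v = feCoeff R' v)
    (hef : ∀ v : GTVertex n, v.row + 1 = k → efCoeff R v = efCoeff R' v) :
    AgreeBelow (k + 1) R R' := by
  classical
  have hRr := isRealization_of_mem hL hR
  have hRr' := isRealization_of_mem hL hR'
  have hnc := hRr.noncritical hadm
  have hsum : ∑ w ∈ rowSet n k, R w = ∑ w ∈ rowSet n k, R' w := by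
    unfold hCoeff at hh
    rw [Finset.sum_congr (s₁ := rowBelow n k) rfl fun w hw =>
      hag w (by have := mem_rowBelow.1 hw; omega)] at hh
    linear_combination hh
  set d := Lagrange.nodal (rowSet n k) R - Lagrange.nodal (rowSet n k) R' with hd
  have hdeg : d.degree < (k : ℕ) := degree_nodal_sub_lt (by omega) hsum
  have hev : ∀ x, d.eval x = ∏ w ∈ rowSet n k, (x - R w) - ∏ w ∈ rowSet n k, (x - R' w) := by
    intro x
    rw [hd, eval_sub, Lagrange.eval_nodal, Lagrange.eval_nodal]
  have hd0 : d = 0 := by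
    by_contra hd0
    obtain _ | r := k
    · rw [Nat.cast_zero, degree_eq_natDegree hd0] at hdeg
      exact absurd (by exact_mod_cast hdeg) (Nat.not_lt_zero d.natDegree)
    have hinj : Set.InjOn R (rowSet n r) := by
      intro a ha b hb hab
      by_contra hne
      have ha' := mem_rowSet.1 ha
      have hb' := mem_rowSet.1 hb
      exact hnc a b (ha'.trans hb'.symm) (by omega) hne hab
    have hblock : ∀ v w : GTVertex n, v.row = r → w.row = r → R w = R v + 1 →
        d.eval (R v) = 0 ∧ ∃ a ∈ rowBelow n r, R a - 1 = R v := by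
      intro v w hv hw h
      have hv' : R' v = R v := (hag v (by omega)).symm
      have hw' : R' w = R w := (hag w (by omega)).symm
      obtain ⟨⟨c, hc, hcv⟩, a, ha, hav⟩ :=
        exists_blocking hadm hRr (hv.trans hw.symm) (by omega) h
      obtain ⟨⟨c', hc', hcv'⟩, -⟩ :=
        exists_blocking hadm hRr' (hv.trans hw.symm) (by omega) (by rw [hv', hw', h])
      refine ⟨?_, a, mem_rowBelow.2 (by omega), by rw [hav]; ring⟩
      rw [hev, Finset.prod_eq_zero (mem_rowSet.2 (hc.trans (by omega))) (by rw [hcv, sub_self]),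
        Finset.prod_eq_zero (mem_rowSet.2 (hc'.trans (by omega))) (by rw [hcv', hv', sub_self]),
        sub_self]
    set A₁ := (rowSet n r).image R with hA₁
    set A₂ := (rowSet n r).image fun v => R v - 1 with hA₂
    set Zd := d.roots.toFinset with hZd
    set Zq := (rowBelow n r).image fun v => R v - 1 with hZq
    have hmemd : ∀ x, x ∈ Zd ↔ d.eval x = 0 := fun x => by
      rw [hZd, Multiset.mem_toFinset, mem_roots hd0, IsRoot]
    have hmemq : ∀ x, x ∈ Zq ↔ ∃ a ∈ rowBelow n r, R a - 1 = x := fun x => by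
      rw [hZq, Finset.mem_image]
    have c1 : A₁.card = r + 1 := by rw [hA₁, Finset.card_image_of_injOn hinj, card_rowSet (by omega)]
    have c2 : A₂.card = r + 1 := by
      rw [hA₂, Finset.card_image_of_injOn, card_rowSet (by omega)]
      intro a ha b hb hab
      exact hinj ha hb (sub_left_injective hab)
    have c3 : Zd.card ≤ r := by
      have h1 : d.roots.card ≤ d.natDegree := card_roots' d
      have h2 : Zd.card ≤ d.roots.card := Multiset.toFinset_card_le _
      rw [degree_eq_natDegree hd0] at hdeg
      have h3 : d.natDegree < r + 1 := by exact_mod_cast hdeg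
      omega
    have c4 : Zq.card ≤ r := Finset.card_image_le.trans (card_rowBelow (by omega)).le
    have hprod : ∀ v : GTVertex n, v.row = r → ∀ x, (∃ a ∈ rowBelow n r, R a - 1 = x) ∨
        ∏ w ∈ rowBelow n v.row, (x + 1 - R w) ≠ 0 := by
      intro v hv x
      by_cases h : ∏ w ∈ rowBelow n v.row, (x + 1 - R w) = 0
      · obtain ⟨a, ha, hax⟩ := Finset.prod_eq_zero_iff.1 h
        exact Or.inl ⟨a, hv ▸ ha, by linear_combination -hax⟩
      · exact Or.inr h
    have hden : ∀ v : GTVertex n, v.row = r → ∏ w ∈ (rowSet n v.row).erase v, (R v - R w) ≠ 0 := by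
      intro v hv
      rw [Finset.prod_ne_zero_iff]
      intro w hw h
      have hw' := mem_rowSet.1 (Finset.mem_of_mem_erase hw)
      exact Finset.ne_of_mem_erase hw (hinj (mem_rowSet.2 (hw'.trans hv)) (mem_rowSet.2 hv)
        (sub_eq_zero.1 h).symm)
    have hagv : ∀ v : GTVertex n, v.row = r → R' v = R v := fun v hv => (hag v (by omega)).symm
    have hagb : ∀ v : GTVertex n, v.row = r → ∀ w ∈ rowBelow n v.row, R' w = R w := fun v hv w hw =>
      (hag w (by have := mem_rowBelow.1 hw; omega)).symm
    have hage : ∀ v : GTVertex n, v.row = r → ∀ w ∈ (rowSet n v.row).erase v, R' w = R w :=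
      fun v hv w hw => hagv w ((mem_rowSet.1 (Finset.mem_of_mem_erase hw)).trans hv)
    have hsub1 : ∀ x ∈ A₁, x ∈ Zd ∨ x ∈ Zq := by
      intro x hx
      obtain ⟨v, hv, rfl⟩ := Finset.mem_image.1 hx
      have hv := mem_rowSet.1 hv
      rw [hmemd, hmemq]
      by_cases hw : ∃ w : GTVertex n, w.row = r ∧ R w = R v + 1
      · obtain ⟨w, hw, hwv⟩ := hw
        exact Or.inl (hblock v w hv hw hwv).1
      · rcases hprod v hv (R v) with h | h
        · exact Or.inr h
        · left
          have hden' : ∏ w ∈ (rowSet n v.row).erase v, (R v + 1 - R w) ≠ 0 := by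
            rw [Finset.prod_ne_zero_iff]
            intro w hw' h0
            exact hw ⟨w, (mem_rowSet.1 (Finset.mem_of_mem_erase hw')).trans hv,
              (sub_eq_zero.1 h0).symm⟩
          have h1 := hfe v (by omega)
          unfold feCoeff at h1
          rw [hagv v hv, Finset.prod_congr (s₁ := rowBelow n v.row) (f := fun w => R v + 1 - R' w)
              rfl fun w hw => by rw [hagb v hv w hw],
            Finset.prod_congr (s₁ := (rowSet n v.row).erase v) (f := fun w => R v - R' w) rfl
              fun w hw => by rw [hage v hv w hw],
            Finset.prod_congr (s₁ := (rowSet n v.row).erase v) (f := fun w => R v + 1 - R' w) rfl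
              fun w hw => by rw [hage v hv w hw],
            div_left_inj' (mul_ne_zero (hden v hv) hden'), neg_inj, mul_left_inj' h, hv] at h1
          rw [hev, h1, sub_self]
    have hsub2 : ∀ x ∈ A₂, x ∈ Zd ∨ x ∈ Zq := by
      intro x hx
      obtain ⟨v, hv, rfl⟩ := Finset.mem_image.1 hx
      have hv := mem_rowSet.1 hv
      rw [hmemd, hmemq]
      by_cases hw : ∃ w : GTVertex n, w.row = r ∧ R v = R w + 1
      · obtain ⟨w, hw, hwv⟩ := hw
        left
        have := (hblock w v hw hv hwv).1
        rwa [hwv, add_sub_cancel_right]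
      · rcases hprod v hv (R v - 1) with h | h
        · exact Or.inr h
        · left
          have hden' : ∏ w ∈ (rowSet n v.row).erase v, (R v - 1 - R w) ≠ 0 := by
            rw [Finset.prod_ne_zero_iff]
            intro w hw' h0
            exact hw ⟨w, (mem_rowSet.1 (Finset.mem_of_mem_erase hw')).trans hv,
              by linear_combination h0⟩
          rw [sub_add_cancel] at h
          have h1 := hef v (by omega)
          unfold efCoeff at h1
          rw [hagv v hv, Finset.prod_congr (s₁ := rowBelow n v.row) (f := fun w => R v - R' w)
              rfl fun w hw => by rw [hagb v hv w hw],
            Finset.prod_congr (s₁ := (rowSet n v.row).erase v) (f := fun w => R v - R' w) rfl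
              fun w hw => by rw [hage v hv w hw],
            Finset.prod_congr (s₁ := (rowSet n v.row).erase v) (f := fun w => R v - 1 - R' w) rfl
              fun w hw => by rw [hage v hv w hw],
            div_left_inj' (mul_ne_zero (hden v hv) hden'), neg_inj, mul_right_inj' h, hv] at h1
          rw [hev, h1, sub_self]
    have hU : A₁ ∪ A₂ ⊆ Zd ∪ Zq := by
      intro x hx
      rw [Finset.mem_union] at hx ⊢
      exact hx.elim (hsub1 x) (hsub2 x)
    have hI : A₁ ∩ A₂ ⊆ Zd ∩ Zq := by
      intro x hx
      rw [Finset.mem_inter] at hx ⊢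
      obtain ⟨v, hv, rfl⟩ := Finset.mem_image.1 hx.1
      obtain ⟨w, hw, hwv⟩ := Finset.mem_image.1 hx.2
      have := hblock v w (mem_rowSet.1 hv) (mem_rowSet.1 hw) (by rw [← hwv]; ring)
      rwa [hmemd, hmemq]
    have e1 := Finset.card_union_add_card_inter A₁ A₂
    have e2 := Finset.card_union_add_card_inter Zd Zq
    have e3 := Finset.card_le_card hU
    have e4 := Finset.card_le_card hI
    omega
  have hprodeq : ∀ x, ∏ w ∈ rowSet n k, (x - R w) = ∏ w ∈ rowSet n k, (x - R' w) := by
    intro x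
    have := hev x
    rw [hd0, eval_zero] at this
    exact (sub_eq_zero.1 this.symm)
  intro w hw
  rcases Nat.lt_succ_iff_lt_or_eq.1 hw with hw | hw
  · exact hag w hw
  · refine agree_row_of_image_eq hadm hL hR hR' hk (fun w hw => ?_) (fun w hw => ?_) w hw
    · have := hprodeq (R w)
      rw [Finset.prod_eq_zero (mem_rowSet.2 hw) (sub_self _), eq_comm, Finset.prod_eq_zero_iff] at this
      obtain ⟨u, hu, h⟩ := this
      exact ⟨u, mem_rowSet.1 hu, (sub_eq_zero.1 h).symm⟩
    · have := hprodeq (R' w)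
      rw [eq_comm, Finset.prod_eq_zero (mem_rowSet.2 hw) (sub_self _), eq_comm, Finset.prod_eq_zero_iff] at this
      obtain ⟨u, hu, h⟩ := this
      exact ⟨u, mem_rowSet.1 hu, (sub_eq_zero.1 h).symm⟩

section Module

variable {C : Set (GTRel n)} {L : GTTableau n}
  [LieRingModule (Matrix (Fin n) (Fin n) ℂ) (Space C L)]
  [LieModule ℂ (Matrix (Fin n) (Fin n) ℂ) (Space C L)]

theorem lie_eq_diagOp_hCoeff (hGT : IsGTModule C L) (k : Fin n) (y : Space C L) :
    ⁅(Matrix.single k k 1 : Matrix (Fin n) (Fin n) ℂ), y⁆ =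
      diagOp (fun R : basisSet C L => hCoeff (R : GTTableau n) k) y := by
  refine eq_diagOp_of_single (LieModule.toEnd ℂ _ (Space C L)
    (Matrix.single k k 1 : Matrix (Fin n) (Fin n) ℂ)) _ y fun R _ => ?_
  rw [← vec_of_mem R.2, LieModule.toEnd_apply_apply, hGT.diag k R R.2]

theorem proj_lower_proj_raise_eq_diagOp (hGT : IsGTModule C L) {k k' : Fin n}
    (hk : (k' : ℕ) = k + 1) {u : GTVertex n} (hu : u.row = k) {l : ℕ} (hl : (k : ℕ) < l)
    {S : GTTableau n} (y : Space C L) (hy : ∀ R ∈ y.support, AgreeBelow l (R : GTTableau n) S) :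
    proj C L (AgreeBelow l · S) ⁅(Matrix.single k' k 1 : Matrix (Fin n) (Fin n) ℂ),
      proj C L (AgreeBelow l · (S + delta u))
        ⁅(Matrix.single k k' 1 : Matrix (Fin n) (Fin n) ℂ), y⁆⁆ =
      diagOp (fun R : basisSet C L => feCoeff (R : GTTableau n) u) y := by
  refine eq_diagOp_of_single (proj C L (AgreeBelow l · S) ∘ₗ
    LieModule.toEnd ℂ _ (Space C L) (Matrix.single k' k 1 : Matrix (Fin n) (Fin n) ℂ) ∘ₗ
    proj C L (AgreeBelow l · (S + delta u)) ∘ₗ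
    LieModule.toEnd ℂ _ (Space C L) (Matrix.single k k' 1 : Matrix (Fin n) (Fin n) ℂ)) _ y
    fun R hR => ?_
  rw [← vec_of_mem R.2]
  exact proj_lower_proj_raise hGT hk hu hl R.2 (hy R hR)

theorem proj_raise_proj_lower_eq_diagOp (hGT : IsGTModule C L) {k k' : Fin n}
    (hk : (k' : ℕ) = k + 1) {u : GTVertex n} (hu : u.row = k) {l : ℕ} (hl : (k : ℕ) < l)
    {S : GTTableau n} (y : Space C L) (hy : ∀ R ∈ y.support, AgreeBelow l (R : GTTableau n) S) :
    proj C L (AgreeBelow l · S) ⁅(Matrix.single k k' 1 : Matrix (Fin n) (Fin n) ℂ),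
      proj C L (AgreeBelow l · (S - delta u))
        ⁅(Matrix.single k' k 1 : Matrix (Fin n) (Fin n) ℂ), y⁆⁆ =
      diagOp (fun R : basisSet C L => efCoeff (R : GTTableau n) u) y := by
  refine eq_diagOp_of_single (proj C L (AgreeBelow l · S) ∘ₗ
    LieModule.toEnd ℂ _ (Space C L) (Matrix.single k k' 1 : Matrix (Fin n) (Fin n) ℂ) ∘ₗ
    proj C L (AgreeBelow l · (S - delta u)) ∘ₗ
    LieModule.toEnd ℂ _ (Space C L) (Matrix.single k' k 1 : Matrix (Fin n) (Fin n) ℂ)) _ y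
    fun R hR => ?_
  rw [← vec_of_mem R.2]
  exact proj_raise_proj_lower hGT hk hu hl R.2 (hy R hR)

/-- A submodule contains the projections of its elements to the tableaux with given lower rows. -/
theorem proj_mem_of_mem (hadm : Admissible C) (hL : IsRealization C L) (hGT : IsGTModule C L)
    (N : LieSubmodule ℂ (Matrix (Fin n) (Fin n) ℂ) (Space C L)) {k : ℕ} (hk : k ≤ n)
    (S : GTTableau n) (x : Space C L) (hx : x ∈ N) : proj C L (AgreeBelow k · S) x ∈ N := by
  classical
  induction k generalizing S x with
  | zero =>
    have : proj C L (AgreeBelow 0 · S) x = x := by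
      ext R
      exact (proj_apply _ _ _).trans (if_pos fun v hv => absurd hv (Nat.not_lt_zero _))
    rwa [this]
  | succ k ih =>
    have ih := ih (by omega)
    set W : Submodule ℂ (Space C L) :=
      N.toSubmodule ⊓ Finsupp.supported ℂ ℂ {R : basisSet C L | AgreeBelow k (R : GTTableau n) S}
      with hW
    have hWN : ∀ y, y ∈ W → y ∈ N := fun y hy => hy.1
    have hWS : ∀ y, y ∈ W → ∀ R ∈ y.support, AgreeBelow k (R : GTTableau n) S :=
      fun y hy R hR => (Finsupp.mem_supported _ _).1 hy.2 hR
    have hdiag : ∀ (g : GTTableau n → ℂ), (∀ y ∈ W, diagOp (fun R : basisSet C L => g R) y ∈ N) →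
        ∀ y ∈ W, diagOp (fun R : basisSet C L => g R) y ∈ W := by
      intro g hg y hy
      refine ⟨hg y hy, (Finsupp.mem_supported _ _).2 fun R hR => hWS y hy R ?_⟩
      rw [Finset.mem_coe, Finsupp.mem_support_iff, diagOp_apply] at hR
      exact Finsupp.mem_support_iff.2 (right_ne_zero_of_mul hR)
    have hxW : proj C L (AgreeBelow k · S) x ∈ W := by
      refine ⟨ih S x hx, (Finsupp.mem_supported _ _).2 fun R hR => ?_⟩
      rw [Finset.mem_coe, Finsupp.mem_support_iff, proj_apply] at hR
      by_contra h
      exact hR (if_neg h)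
    have hproj : proj C L (AgreeBelow (k + 1) · S) x =
        (proj C L (AgreeBelow k · S) x).filter
          fun R : basisSet C L => AgreeBelow (k + 1) (R : GTTableau n) S := by
      ext R
      rw [proj_apply, Finsupp.filter_apply, proj_apply]
      by_cases h : AgreeBelow (k + 1) (R : GTTableau n) S
      · rw [if_pos h, if_pos h, if_pos (h.mono (Nat.le_succ k))]
      · rw [if_neg h, if_neg h]
    rw [hproj]
    by_cases hex : ∃ r : basisSet C L, AgreeBelow (k + 1) (r : GTTableau n) S
    swap
    · have : (proj C L (AgreeBelow k · S) x).filter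
          (fun R : basisSet C L => AgreeBelow (k + 1) (R : GTTableau n) S) = 0 := by
        ext R
        rw [Finsupp.filter_apply, if_neg fun h => hex ⟨R, h⟩, Finsupp.zero_apply]
      rw [this]
      exact N.zero_mem
    obtain ⟨r, hr⟩ := hex
    refine hWN _ (filter_mem_of_separating W _ r ?_ _ hxW)
    intro y hy s hs hns
    have hsS := hWS y hy s hs
    have hsr : AgreeBelow k (s : GTTableau n) r := hsS.trans (hr.mono (Nat.le_succ k)).symm
    by_contra hcon
    push Not at hcon
    refine hns (AgreeBelow.trans ?_ hr)
    by_cases hkn : k + 1 = n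
    · intro v hv
      rcases Nat.lt_succ_iff_lt_or_eq.1 hv with hv | hv
      · exact hsr v hv
      · rw [s.2.1.eq_of_top (by omega), r.2.1.eq_of_top (by omega)]
    refine agreeBelow_succ_of_coeff_eq hadm hL s.2 r.2 (by omega) hsr ?_ ?_ ?_
    · refine hcon (fun R => hCoeff (R : GTTableau n) k) (hdiag (hCoeff · k) fun y hy => ?_)
        fun t ht => hCoeff_congr (ht.trans hr.symm)
      exact lie_eq_diagOp_hCoeff hGT ⟨k, hk⟩ y ▸ N.lie_mem (hWN y hy)
    · intro v hv
      have hk' : ((⟨k, hk⟩ : Fin n) : ℕ) = (v.1 : ℕ) + 1 := hv.symm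
      refine hcon (fun R => feCoeff (R : GTTableau n) v) (hdiag (feCoeff · v) fun y hy => ?_)
        fun t ht => feCoeff_congr (by rw [show v.row + 2 = k + 1 by omega]; exact ht.trans hr.symm)
      rw [← proj_lower_proj_raise_eq_diagOp hGT hk' rfl (by rw [← hv]; exact Nat.lt_succ_self _) y (hWS y hy)]
      exact ih _ _ (N.lie_mem (ih _ _ (N.lie_mem (hWN y hy))))
    · intro v hv
      have hk' : ((⟨k, hk⟩ : Fin n) : ℕ) = (v.1 : ℕ) + 1 := hv.symm
      refine hcon (fun R => efCoeff (R : GTTableau n) v) (hdiag (efCoeff · v) fun y hy => ?_)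
        fun t ht => efCoeff_congr (by rw [show v.row + 2 = k + 1 by omega]; exact ht.trans hr.symm)
      rw [← proj_raise_proj_lower_eq_diagOp hGT hk' rfl (by rw [← hv]; exact Nat.lt_succ_self _) y (hWS y hy)]
      exact ih _ _ (N.lie_mem (ih _ _ (N.lie_mem (hWN y hy))))

/-- A submodule contains all tableaux that occur in one of its elements. -/
theorem vec_mem_of_apply_ne_zero (hadm : Admissible C) (hL : IsRealization C L)
    (hGT : IsGTModule C L) (N : LieSubmodule ℂ (Matrix (Fin n) (Fin n) ℂ) (Space C L))
    {x : Space C L} (hx : x ∈ N) {R : basisSet C L} (hR : x R ≠ 0) : vec C L R ∈ N := by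
  classical
  have h := proj_mem_of_mem hadm hL hGT N le_rfl (R : GTTableau n) x hx
  have heq : proj C L (AgreeBelow n · (R : GTTableau n)) x = x R • vec C L R := by
    ext S
    rw [proj_apply, Finsupp.smul_apply, vec_apply, smul_eq_mul]
    by_cases hS : (R : GTTableau n) = S
    · have : R = S := Subtype.ext hS
      subst this
      rw [if_pos (AgreeBelow.refl n _), if_pos rfl, mul_one]
    · rw [if_neg hS, mul_zero, if_neg]
      intro h
      exact hS (funext fun v => (h v v.1.2).symm)
  rw [heq] at h
  have := N.smul_mem (x R)⁻¹ h
  rwa [inv_smul_smul₀ hR] at this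

end Module

end GT

namespace GTRel

variable {n : ℕ}

theorem gap_eq_one {r : GTRel n} (h : r.src.row + 1 = r.tgt.row) : r.gap = 1 := by
  rcases r with ⟨a, b, hab⟩ | ⟨a, b, hab⟩ | ⟨a, b, ha, hb, hab⟩
  · simp only [src, tgt] at h
    omega
  · rfl
  · simp only [src, tgt] at h
    omega

end GTRel

namespace GT

variable {n : ℕ}

open GTTableau

theorem IsMaximalFor.holds {C : Set (GTRel n)} {L : GTTableau n} (h : IsMaximalFor C L)
    {r : GTRel n} (hr : r.Holds L) {R : GTTableau n} (hR : R ∈ basisSet C L) : r.Holds R :=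
  h.2 {r} (by rintro _ rfl; exact hr) R hR.1 hR.2 r rfl

theorem exists_int_sub_of_mem {C : Set (GTRel n)} {L R : GTTableau n} (hR : R ∈ basisSet C L)
    {v w : GTVertex n} (h : R v = R w) : ∃ d : ℤ, L v - L w = d := by
  obtain ⟨d, hd⟩ := hR.1.exists_int v
  obtain ⟨e, he⟩ := hR.1.exists_int w
  exact ⟨e - d, by push_cast; rw [← hd, ← he, h]; ring⟩

theorem prod_row_sub_ne_zero {R : GTTableau n} (hR : R.Noncritical) {v : GTVertex n}
    (hv : v.row + 1 < n) : ∏ w ∈ (rowSet n v.row).erase v, (R v - R w) ≠ 0 := by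
  rw [Finset.prod_ne_zero_iff]
  intro w hw h
  exact hR v w (mem_rowSet.1 (Finset.mem_of_mem_erase hw)).symm hv
    (Finset.ne_of_mem_erase hw).symm (sub_eq_zero.1 h)

theorem eCoeff_ne_zero {C : Set (GTRel n)} (hadm : Admissible C) {L R : GTTableau n}
    (hL : IsRealization C L) (hmax : IsMaximalFor C L) (hR : R ∈ basisSet C L) {v : GTVertex n}
    (hv : v.row + 1 < n) (h : R + delta v ∈ basisSet C L) : eCoeff R v ≠ 0 := by
  refine neg_ne_zero.2 (div_ne_zero ?_
    (prod_row_sub_ne_zero ((isRealization_of_mem hL hR).noncritical hadm) hv))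
  rw [Finset.prod_ne_zero_iff]
  intro w hw h0
  have hw := mem_rowSet.1 hw
  have hRw : R w = R v := (sub_eq_zero.1 h0).symm
  have hne : w ≠ v := by rintro rfl; omega
  obtain ⟨d, hd⟩ := exists_int_sub_of_mem hR hRw
  rcases le_or_gt 0 d with h1 | h1
  · have h2 := hmax.holds (r := GTRel.down w v hw) ((GTRel.holds_iff_int hd).2 h1) h
    have h3 : (R + delta v) w - (R + delta v) v = ((-1 : ℤ) : ℂ) := by
      rw [Pi.add_apply, Pi.add_apply, delta_self, delta_of_ne hne, hRw]
      push_cast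
      ring
    have h4 : (0 : ℤ) ≤ -1 := (GTRel.holds_iff_int (r := GTRel.down w v hw) h3).1 h2
    omega
  · have hd' : L v - L w = ((-d : ℤ) : ℂ) := by push_cast; rw [← hd]; ring
    have h2 := hmax.holds (r := GTRel.up v w hw)
      ((GTRel.holds_iff_int hd').2 (show (1 : ℤ) ≤ -d by omega)) hR
    have h3 : R v - R w = ((0 : ℤ) : ℂ) := by rw [hRw, sub_self, Int.cast_zero]
    have h4 : (1 : ℤ) ≤ 0 := (GTRel.holds_iff_int (r := GTRel.up v w hw) h3).1 h2
    omega

theorem fCoeff_ne_zero {C : Set (GTRel n)} (hadm : Admissible C) {L R : GTTableau n}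
    (hL : IsRealization C L) (hmax : IsMaximalFor C L) (hR : R ∈ basisSet C L) {v : GTVertex n}
    (hv : v.row + 1 < n) (h : R - delta v ∈ basisSet C L) : fCoeff R v ≠ 0 := by
  refine div_ne_zero ?_
    (prod_row_sub_ne_zero ((isRealization_of_mem hL hR).noncritical hadm) hv)
  rw [Finset.prod_ne_zero_iff]
  intro w hw h0
  have hw := mem_rowBelow.1 hw
  have hRw : R v = R w := sub_eq_zero.1 h0
  have hne : w ≠ v := by rintro rfl; omega
  obtain ⟨d, hd⟩ := exists_int_sub_of_mem hR hRw
  rcases le_or_gt 0 d with h1 | h1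
  · have h2 := hmax.holds (r := GTRel.down v w hw.symm) ((GTRel.holds_iff_int hd).2 h1) h
    have h3 : (R - delta v) v - (R - delta v) w = ((-1 : ℤ) : ℂ) := by
      rw [Pi.sub_apply, Pi.sub_apply, delta_self, delta_of_ne hne, hRw]
      push_cast
      ring
    have h4 : (0 : ℤ) ≤ -1 := (GTRel.holds_iff_int (r := GTRel.down v w hw.symm) h3).1 h2
    omega
  · have hd' : L w - L v = ((-d : ℤ) : ℂ) := by push_cast; rw [← hd]; ring
    have h2 := hmax.holds (r := GTRel.up w v hw.symm)
      ((GTRel.holds_iff_int hd').2 (show (1 : ℤ) ≤ -d by omega)) hR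
    have h3 : R w - R v = ((0 : ℤ) : ℂ) := by rw [hRw, sub_self, Int.cast_zero]
    have h4 : (1 : ℤ) ≤ 0 := (GTRel.holds_iff_int (r := GTRel.up w v hw.symm) h3).1 h2
    omega

/-- If some entries of `R` are smaller than those of `R'`, one of them can be raised. -/
theorem exists_add_delta_mem {C : Set (GTRel n)} {L R R' : GTTableau n} (hR : R ∈ basisSet C L)
    (hR' : R' ∈ basisSet C L) {z : GTVertex n → ℤ} (hz : ∀ v, R' v - R v = z v)
    (hz0 : ∀ v, v.row + 1 = n → z v = 0) (h : ∃ v, 0 < z v) :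
    ∃ v, 0 < z v ∧ R + delta v ∈ basisSet C L := by
  classical
  obtain ⟨v, hv, hmax⟩ := Finset.exists_max_image (Finset.univ.filter fun v => 0 < z v)
    (fun v => 2 * (R v).re + v.row) (by
      obtain ⟨v, hv⟩ := h
      exact ⟨v, by simpa using hv⟩)
  have hv : 0 < z v := by simpa using hv
  refine ⟨v, hv, ?_⟩
  by_contra hmem
  have hrow : v.row + 1 < n := by
    have h1 : v.row < n := v.1.2
    rcases Nat.eq_or_lt_of_le (Nat.succ_le_of_lt h1) with h2 | h2
    · have := hz0 v h2
      omega
    · exact h2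
  rcases blocked_of_add_delta_notMem hR hrow hmem with
    ⟨c, hc, hcv, r, hr, rfl, rfl⟩ | ⟨c, hc, hcv, r, hr, rfl, rfl⟩
  · obtain ⟨d, hd, hg⟩ := (hR'.2 r hr).exists_int
    have h1 : z r.src = z r.tgt + d := by
      have : (z r.src : ℂ) = ((z r.tgt + d : ℤ) : ℂ) := by
        push_cast
        rw [← hz, ← hz, ← hd, hcv]
        ring
      exact_mod_cast this
    have h2 := hmax r.src (by simp; omega)
    rw [hcv, hc] at h2
    push_cast at h2
    linarith
  · obtain ⟨d, hd, hg⟩ := (hR'.2 r hr).exists_int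
    rw [GTRel.gap_eq_one hc] at hg
    have h1 : z r.src = z r.tgt + d - 1 := by
      have : (z r.src : ℂ) = ((z r.tgt + d - 1 : ℤ) : ℂ) := by
        push_cast
        rw [← hz, ← hz, ← hd, hcv]
        ring
      exact_mod_cast this
    have h2 := hmax r.src (by simp; omega)
    rw [hcv, ← hc, Complex.add_re, Complex.one_re] at h2
    push_cast at h2
    linarith

/-- If some entries of `R` are larger than those of `R'`, one of them can be lowered. -/
theorem exists_sub_delta_mem {C : Set (GTRel n)} {L R R' : GTTableau n} (hR : R ∈ basisSet C L)
    (hR' : R' ∈ basisSet C L) {z : GTVertex n → ℤ} (hz : ∀ v, R' v - R v = z v)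
    (hz0 : ∀ v, v.row + 1 = n → z v = 0) (h : ∃ v, z v < 0) :
    ∃ v, z v < 0 ∧ R - delta v ∈ basisSet C L := by
  classical
  obtain ⟨v, hv, hmin⟩ := Finset.exists_min_image (Finset.univ.filter fun v => z v < 0)
    (fun v => 2 * (R v).re + v.row) (by
      obtain ⟨v, hv⟩ := h
      exact ⟨v, by simpa using hv⟩)
  have hv : z v < 0 := by simpa using hv
  refine ⟨v, hv, ?_⟩
  by_contra hmem
  have hrow : v.row + 1 < n := by
    have h1 : v.row < n := v.1.2
    rcases Nat.eq_or_lt_of_le (Nat.succ_le_of_lt h1) with h2 | h2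
    · have := hz0 v h2
      omega
    · exact h2
  rcases blocked_of_sub_delta_notMem hR hrow hmem with
    ⟨c, hc, hcv, r, hr, rfl, rfl⟩ | ⟨c, hc, hcv, r, hr, rfl, rfl⟩
  · obtain ⟨d, hd, hg⟩ := (hR'.2 r hr).exists_int
    rw [GTRel.gap_eq_one hc.symm] at hg
    have h1 : z r.tgt = z r.src - d + 1 := by
      have : (z r.tgt : ℂ) = ((z r.src - d + 1 : ℤ) : ℂ) := by
        push_cast
        rw [← hz, ← hz, ← hd, hcv]
        ring
      exact_mod_cast this
    have h2 := hmin r.tgt (by simp; omega)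
    rw [hcv, hc, Complex.sub_re, Complex.one_re] at h2
    push_cast at h2
    linarith
  · obtain ⟨d, hd, hg⟩ := (hR'.2 r hr).exists_int
    have h1 : z r.tgt = z r.src - d := by
      have : (z r.tgt : ℂ) = ((z r.src - d : ℤ) : ℂ) := by
        push_cast
        rw [← hz, ← hz, ← hd, hcv]
        ring
      exact_mod_cast this
    have h2 := hmin r.tgt (by simp; omega)
    rw [hcv, ← hc] at h2
    push_cast at h2
    linarith

section Module

variable {C : Set (GTRel n)} {L : GTTableau n}
  [LieRingModule (Matrix (Fin n) (Fin n) ℂ) (Space C L)]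
  [LieModule ℂ (Matrix (Fin n) (Fin n) ℂ) (Space C L)]

theorem vec_add_delta_mem (hadm : Admissible C) (hL : IsRealization C L) (hGT : IsGTModule C L)
    (hmax : IsMaximalFor C L) (N : LieSubmodule ℂ (Matrix (Fin n) (Fin n) ℂ) (Space C L))
    {R : GTTableau n} (hR : R ∈ basisSet C L) (hN : vec C L R ∈ N) {v : GTVertex n}
    (hv : v.row + 1 < n) (h : R + delta v ∈ basisSet C L) : vec C L (R + delta v) ∈ N := by
  refine vec_mem_of_apply_ne_zero hadm hL hGT N
    (N.lie_mem (x := (Matrix.single v.1 ⟨v.row + 1, hv⟩ 1 : Matrix (Fin n) (Fin n) ℂ)) hN)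
    (R := ⟨R + delta v, h⟩) ?_
  rw [hGT.raise v.1 ⟨v.row + 1, hv⟩ rfl R hR, Finsupp.finsetSum_apply, Finset.sum_eq_single v]
  · rw [Finsupp.smul_apply, vec_apply, if_pos rfl, smul_eq_mul, mul_one]
    exact eCoeff_ne_zero hadm hL hmax hR hv h
  · intro w _ hw
    rw [Finsupp.smul_apply, vec_apply, if_neg, smul_zero]
    exact fun h => hw (delta_injective (add_left_cancel h))
  · exact fun h => absurd (mem_rowSet.2 rfl) h

theorem vec_sub_delta_mem (hadm : Admissible C) (hL : IsRealization C L) (hGT : IsGTModule C L)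
    (hmax : IsMaximalFor C L) (N : LieSubmodule ℂ (Matrix (Fin n) (Fin n) ℂ) (Space C L))
    {R : GTTableau n} (hR : R ∈ basisSet C L) (hN : vec C L R ∈ N) {v : GTVertex n}
    (hv : v.row + 1 < n) (h : R - delta v ∈ basisSet C L) : vec C L (R - delta v) ∈ N := by
  refine vec_mem_of_apply_ne_zero hadm hL hGT N
    (N.lie_mem (x := (Matrix.single ⟨v.row + 1, hv⟩ v.1 1 : Matrix (Fin n) (Fin n) ℂ)) hN)
    (R := ⟨R - delta v, h⟩) ?_
  rw [hGT.lower v.1 ⟨v.row + 1, hv⟩ rfl R hR, Finsupp.finsetSum_apply, Finset.sum_eq_single v]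
  · rw [Finsupp.smul_apply, vec_apply, if_pos rfl, smul_eq_mul, mul_one]
    exact fCoeff_ne_zero hadm hL hmax hR hv h
  · intro w _ hw
    rw [Finsupp.smul_apply, vec_apply, if_neg, smul_zero]
    exact fun h => hw (delta_injective (sub_right_injective h))
  · exact fun h => absurd (mem_rowSet.2 rfl) h

theorem vec_mem_of_vec_mem (hadm : Admissible C) (hL : IsRealization C L) (hGT : IsGTModule C L)
    (hmax : IsMaximalFor C L) (N : LieSubmodule ℂ (Matrix (Fin n) (Fin n) ℂ) (Space C L))
    {R R' : GTTableau n} (hR : R ∈ basisSet C L) (hR' : R' ∈ basisSet C L) (hN : vec C L R ∈ N) :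
    vec C L R' ∈ N := by
  classical
  obtain ⟨z, hz0, hz'⟩ := hR.1.symm.trans hR'.1
  have hz : ∀ v, R' v - R v = z v := fun v => by rw [hz']; ring
  clear hz'
  induction hs : ∑ v, (z v).natAbs using Nat.strong_induction_on generalizing R z with
  | _ s ih =>
    have hlt : ∀ (v : GTVertex n) (z' : GTVertex n → ℤ), (z' v).natAbs < (z v).natAbs →
        (∀ w, w ≠ v → z' w = z w) → ∑ w, (z' w).natAbs < s := by
      intro v z' hv hw
      rw [← hs]
      refine Finset.sum_lt_sum (fun w _ => ?_) ⟨v, Finset.mem_univ v, hv⟩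
      by_cases h : w = v
      · rw [h]; exact hv.le
      · rw [hw w h]
    have hrow : ∀ v, z v ≠ 0 → v.row + 1 < n := by
      intro v hv
      have h1 : v.row < n := v.1.2
      have h2 : v.row + 1 ≠ n := fun h => hv (hz0 v h)
      omega
    by_cases hpos : ∃ v, 0 < z v
    · obtain ⟨v, hv, hmem⟩ := exists_add_delta_mem hR hR' hz hz0 hpos
      have hv' := hrow v hv.ne'
      refine ih _ (hlt v (z - Pi.single v 1) ?_ ?_) hmem
        (vec_add_delta_mem hadm hL hGT hmax N hR hN hv' hmem) (z - Pi.single v 1) ?_ ?_ rfl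
      · rw [Pi.sub_apply, Pi.single_eq_same]; omega
      · intro w hw
        rw [Pi.sub_apply, Pi.single_eq_of_ne hw, sub_zero]
      · intro w hw
        rw [Pi.sub_apply, hz0 w hw, Pi.single_eq_of_ne, sub_zero]
        rintro rfl
        omega
      · intro w
        rw [Pi.add_apply, delta_eq_intCast, Pi.sub_apply, Int.cast_sub, ← hz w]
        ring
    · by_cases hneg : ∃ v, z v < 0
      · obtain ⟨v, hv, hmem⟩ := exists_sub_delta_mem hR hR' hz hz0 hneg
        have hv' := hrow v hv.ne
        refine ih _ (hlt v (z + Pi.single v 1) ?_ ?_) hmem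
          (vec_sub_delta_mem hadm hL hGT hmax N hR hN hv' hmem) (z + Pi.single v 1) ?_ ?_ rfl
        · rw [Pi.add_apply, Pi.single_eq_same]; omega
        · intro w hw
          rw [Pi.add_apply, Pi.single_eq_of_ne hw, add_zero]
        · intro w hw
          rw [Pi.add_apply, hz0 w hw, Pi.single_eq_of_ne, add_zero]
          rintro rfl
          omega
        · intro w
          rw [Pi.sub_apply, delta_eq_intCast, Pi.add_apply, Int.cast_add, ← hz w]
          ring
      · have : R = R' := by
          funext v
          have h1 : z v = 0 := by
            by_contra h
            rcases lt_or_gt_of_ne h with h | h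
            · exact hneg ⟨v, h⟩
            · exact hpos ⟨v, h⟩
          have := hz v
          rw [h1, Int.cast_zero] at this
          exact (sub_eq_zero.1 this).symm
        rwa [← this]

theorem isIrreducible_of_isMaximalFor (hadm : Admissible C) (hL : IsRealization C L)
    (hGT : IsGTModule C L) (hmax : IsMaximalFor C L) :
    LieModule.IsIrreducible ℂ (Matrix (Fin n) (Fin n) ℂ) (Space C L) := by
  have : Nonempty (basisSet C L) := ⟨⟨L, self_mem_basisSet hL.1⟩⟩
  refine LieModule.IsIrreducible.mk fun N hN => ?_
  obtain ⟨x, hx, hx0⟩ := (Submodule.ne_bot_iff N.toSubmodule).1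
    (mt (LieSubmodule.toSubmodule_eq_bot N).1 hN)
  obtain ⟨R, hR⟩ := Finsupp.ne_iff.1 hx0
  have hRN := vec_mem_of_apply_ne_zero hadm hL hGT N hx hR
  rw [eq_top_iff]
  intro y _
  rw [← Finsupp.sum_single y]
  refine N.toSubmodule.sum_mem fun S _ => ?_
  have hS := vec_mem_of_vec_mem hadm hL hGT hmax N R.2 S.2 hRN
  rw [vec_of_mem S.2] at hS
  have := N.smul_mem (y S) hS
  rwa [Finsupp.smul_single, smul_eq_mul, mul_one] at this

end Module

/-- The matrix units next to or on the diagonal generate `gl_n`. -/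
theorem lie_mem_of_generators {V : Type*} [AddCommGroup V] [Module ℂ V]
    [LieRingModule (Matrix (Fin n) (Fin n) ℂ) V] [LieModule ℂ (Matrix (Fin n) (Fin n) ℂ) V]
    (W : Submodule ℂ V)
    (hdiag : ∀ k : Fin n, ∀ y ∈ W, ⁅(Matrix.single k k 1 : Matrix (Fin n) (Fin n) ℂ), y⁆ ∈ W)
    (hraise : ∀ k k' : Fin n, (k' : ℕ) = k + 1 → ∀ y ∈ W,
      ⁅(Matrix.single k k' 1 : Matrix (Fin n) (Fin n) ℂ), y⁆ ∈ W)
    (hlower : ∀ k k' : Fin n, (k' : ℕ) = k + 1 → ∀ y ∈ W,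
      ⁅(Matrix.single k' k 1 : Matrix (Fin n) (Fin n) ℂ), y⁆ ∈ W)
    (x : Matrix (Fin n) (Fin n) ℂ) (y : V) (hy : y ∈ W) : ⁅x, y⁆ ∈ W := by
  have hcomm : ∀ i m j : Fin n, i ≠ j →
      (∀ y ∈ W, ⁅(Matrix.single i m 1 : Matrix (Fin n) (Fin n) ℂ), y⁆ ∈ W) →
      (∀ y ∈ W, ⁅(Matrix.single m j 1 : Matrix (Fin n) (Fin n) ℂ), y⁆ ∈ W) →
      ∀ y ∈ W, ⁅(Matrix.single i j 1 : Matrix (Fin n) (Fin n) ℂ), y⁆ ∈ W := by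
    intro i m j hij h1 h2 y hy
    have h : ⁅(Matrix.single i m 1 : Matrix (Fin n) (Fin n) ℂ),
        (Matrix.single m j 1 : Matrix (Fin n) (Fin n) ℂ)⁆ = Matrix.single i j 1 := by
      rw [Ring.lie_def, Matrix.single_mul_single_same, mul_one,
        Matrix.single_mul_single_of_ne (c := (1 : ℂ)) m j i hij.symm, sub_zero]
    rw [← h, lie_lie]
    exact W.sub_mem (h1 _ (h2 y hy)) (h2 _ (h1 y hy))
  have hoff : ∀ (d : ℕ) (i j : Fin n), (j : ℕ) = i + (d + 1) →
      (∀ y ∈ W, ⁅(Matrix.single i j 1 : Matrix (Fin n) (Fin n) ℂ), y⁆ ∈ W) ∧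
      ∀ y ∈ W, ⁅(Matrix.single j i 1 : Matrix (Fin n) (Fin n) ℂ), y⁆ ∈ W := by
    intro d
    induction d with
    | zero => exact fun i j h => ⟨hraise i j h, hlower i j h⟩
    | succ d ih =>
      intro i j h
      have hj := j.2
      have hne : i ≠ j := by
        rintro rfl
        omega
      obtain ⟨a, b⟩ := ih i ⟨i + (d + 1), by omega⟩ rfl
      have hm : (j : ℕ) = (⟨i + (d + 1), by omega⟩ : Fin n) + 1 := h
      exact ⟨hcomm _ _ _ hne a (hraise _ _ hm), hcomm _ _ _ hne.symm (hlower _ _ hm) b⟩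
  have hall : ∀ i j : Fin n, ∀ y ∈ W,
      ⁅(Matrix.single i j 1 : Matrix (Fin n) (Fin n) ℂ), y⁆ ∈ W := by
    intro i j
    rcases lt_trichotomy (i : ℕ) j with h | h | h
    · exact (hoff (j - i - 1) i j (by omega)).1
    · rw [Fin.ext h]
      exact hdiag j
    · exact (hoff (i - j - 1) j i (by omega)).2
  rw [Matrix.matrix_eq_sum_single x, sum_lie]
  refine W.sum_mem fun i _ => ?_
  rw [sum_lie]
  refine W.sum_mem fun j _ => ?_
  have : (Matrix.single i j (x i j) : Matrix (Fin n) (Fin n) ℂ) = x i j • Matrix.single i j 1 := by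
    rw [Matrix.smul_single, smul_eq_mul, mul_one]
  rw [this, smul_lie]
  exact W.smul_mem _ (hall i j y hy)

theorem vec_mem_supported {C : Set (GTRel n)} {L : GTTableau n} {T : Set (basisSet C L)} {R : GTTableau n}
    (h : ∀ hR : R ∈ basisSet C L, ⟨R, hR⟩ ∈ T) : vec C L R ∈ Finsupp.supported ℂ ℂ T := by
  by_cases hR : R ∈ basisSet C L
  · rw [vec_of_mem hR]
    exact Finsupp.single_mem_supported _ _ (h hR)
  · rw [vec_of_notMem hR]
    exact Submodule.zero_mem _

section Module

variable {C : Set (GTRel n)} {L : GTTableau n}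
  [LieRingModule (Matrix (Fin n) (Fin n) ℂ) (Space C L)]
  [LieModule ℂ (Matrix (Fin n) (Fin n) ℂ) (Space C L)]

theorem lie_mem_supported (T : Set (basisSet C L)) (x : Matrix (Fin n) (Fin n) ℂ)
    (h : ∀ R ∈ T, ⁅x, vec C L R⁆ ∈ Finsupp.supported ℂ ℂ T) (y : Space C L)
    (hy : y ∈ Finsupp.supported ℂ ℂ T) : ⁅x, y⁆ ∈ Finsupp.supported ℂ ℂ T := by
  have hsum : y = ∑ R ∈ y.support, y R • vec C L (R : GTTableau n) := by
    conv_lhs => rw [← Finsupp.sum_single y]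
    refine Finset.sum_congr rfl fun R _ => ?_
    rw [vec_of_mem R.2, Finsupp.smul_single, smul_eq_mul, mul_one]
  rw [hsum, lie_sum]
  refine Submodule.sum_mem _ fun R hR => ?_
  rw [lie_smul]
  exact Submodule.smul_mem _ _ (h R ((Finsupp.mem_supported _ _).1 hy hR))

/-- A set of tableaux that is closed under the raising and lowering steps with nonzero coefficients
is empty or everything if the module is irreducible. -/
theorem mem_of_isIrreducible (hGT : IsGTModule C L)
    (hirr : LieModule.IsIrreducible ℂ (Matrix (Fin n) (Fin n) ℂ) (Space C L))
    (T : Set (basisSet C L))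
    (hraise : ∀ R ∈ T, ∀ v, eCoeff (R : GTTableau n) v ≠ 0 →
      ∀ h : (R : GTTableau n) + delta v ∈ basisSet C L, ⟨_, h⟩ ∈ T)
    (hlower : ∀ R ∈ T, ∀ v, fCoeff (R : GTTableau n) v ≠ 0 →
      ∀ h : (R : GTTableau n) - delta v ∈ basisSet C L, ⟨_, h⟩ ∈ T)
    {R₀ : basisSet C L} (hR₀ : R₀ ∈ T) (R : basisSet C L) : R ∈ T := by
  let N : LieSubmodule ℂ (Matrix (Fin n) (Fin n) ℂ) (Space C L) :=
    { Finsupp.supported ℂ ℂ T with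
      lie_mem := by
        intro x y hy
        refine lie_mem_of_generators (Finsupp.supported ℂ ℂ T) ?_ ?_ ?_ x y hy
        · refine fun k => lie_mem_supported T _ fun R hR => ?_
          rw [hGT.diag k R R.2]
          exact Submodule.smul_mem _ _ (vec_mem_supported fun _ => hR)
        · refine fun k k' hk => lie_mem_supported T _ fun R hR => ?_
          rw [hGT.raise k k' hk R R.2]
          refine Submodule.sum_mem _ fun v _ => ?_
          by_cases h0 : eCoeff (R : GTTableau n) v = 0
          · rw [h0, zero_smul]
            exact Submodule.zero_mem _
          · exact Submodule.smul_mem _ _ (vec_mem_supported (hraise R hR v h0))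
        · refine fun k k' hk => lie_mem_supported T _ fun R hR => ?_
          rw [hGT.lower k k' hk R R.2]
          refine Submodule.sum_mem _ fun v _ => ?_
          by_cases h0 : fCoeff (R : GTTableau n) v = 0
          · rw [h0, zero_smul]
            exact Submodule.zero_mem _
          · exact Submodule.smul_mem _ _ (vec_mem_supported (hlower R hR v h0)) }
  have hmem : ∀ y, y ∈ N ↔ y ∈ Finsupp.supported ℂ ℂ T := fun y => Iff.rfl
  rcases hirr.eq_bot_or_eq_top N with h | h
  · have h1 : Finsupp.single R₀ (1 : ℂ) ∈ N := (hmem _).2 (Finsupp.single_mem_supported _ _ hR₀)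
    rw [h, LieSubmodule.mem_bot, Finsupp.single_eq_zero] at h1
    exact absurd h1 one_ne_zero
  · have h1 : Finsupp.single R (1 : ℂ) ∈ N := h ▸ LieSubmodule.mem_top _
    rw [hmem, Finsupp.mem_supported] at h1
    exact h1 (by simp)

theorem isMaximalFor_of_isIrreducible (hL : IsRealization C L) (hGT : IsGTModule C L)
    (hirr : LieModule.IsIrreducible ℂ (Matrix (Fin n) (Fin n) ℂ) (Space C L)) :
    IsMaximalFor C L := by
  refine ⟨hL.1, fun C' hC' R hLR hRC r hr => ?_⟩
  have hLB := self_mem_basisSet hL.1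
  have hRB : R ∈ basisSet C L := ⟨hLR, hRC⟩
  have hr := hC' r hr
  rcases r with ⟨a, b, hab⟩ | ⟨a, b, hab⟩ | ⟨a, b, ha, hb, hab⟩
  · refine mem_of_isIrreducible hGT hirr {S | (GTRel.down a b hab).Holds (S : GTTableau n)}
      ?_ ?_ (R₀ := ⟨L, hLB⟩) hr ⟨R, hRB⟩
    · rintro ⟨S, hS⟩ ⟨m, hm⟩ v hv h
      simp only at hm hv h
      change ∃ m : ℕ, (S + delta v) a - (S + delta v) b = (m : ℂ)
      by_cases hvb : b = v
      · subst hvb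
        have hne : a ≠ b := by rintro rfl; omega
        have hm0 : m ≠ 0 := by
          rintro rfl
          refine hv ?_
          rw [eCoeff, Finset.prod_eq_zero (mem_rowSet.2 hab), zero_div, neg_zero]
          rw [Nat.cast_zero] at hm
          linear_combination -hm
        obtain ⟨k, rfl⟩ := Nat.exists_eq_succ_of_ne_zero hm0
        refine ⟨k, ?_⟩
        rw [Pi.add_apply, Pi.add_apply, delta_self, delta_of_ne hne]
        push_cast at hm
        linear_combination hm
      · by_cases hva : a = v
        · subst hva
          refine ⟨m + 1, ?_⟩
          rw [Pi.add_apply, Pi.add_apply, delta_self, delta_of_ne hvb]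
          push_cast
          linear_combination hm
        · refine ⟨m, ?_⟩
          rw [Pi.add_apply, Pi.add_apply, delta_of_ne hva, delta_of_ne hvb, add_zero, add_zero, hm]
    · rintro ⟨S, hS⟩ ⟨m, hm⟩ v hv h
      simp only at hm hv h
      change ∃ m : ℕ, (S - delta v) a - (S - delta v) b = (m : ℂ)
      by_cases hva : a = v
      · subst hva
        have hne : b ≠ a := by rintro rfl; omega
        have hm0 : m ≠ 0 := by
          rintro rfl
          refine hv ?_
          rw [fCoeff, Finset.prod_eq_zero (mem_rowBelow.2 hab.symm), zero_div]
          rw [hm, Nat.cast_zero]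
        obtain ⟨k, rfl⟩ := Nat.exists_eq_succ_of_ne_zero hm0
        refine ⟨k, ?_⟩
        rw [Pi.sub_apply, Pi.sub_apply, delta_self, delta_of_ne hne]
        push_cast at hm
        linear_combination hm
      · by_cases hvb : b = v
        · subst hvb
          refine ⟨m + 1, ?_⟩
          rw [Pi.sub_apply, Pi.sub_apply, delta_self, delta_of_ne hva]
          push_cast
          linear_combination hm
        · refine ⟨m, ?_⟩
          rw [Pi.sub_apply, Pi.sub_apply, delta_of_ne hva, delta_of_ne hvb, sub_zero, sub_zero, hm]
  · by_contra hnot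
    refine mem_of_isIrreducible hGT hirr {S | ¬ (GTRel.up a b hab).Holds (S : GTTableau n)}
      ?_ ?_ (R₀ := ⟨R, hRB⟩) hnot ⟨L, hLB⟩ hr
    · rintro ⟨S, hS⟩ hSn v hv h ⟨m, hm⟩
      simp only at hSn hv h hm
      refine hSn ?_
      change ∃ m : ℕ, S a - S b = (m : ℂ) + 1
      rw [Pi.add_apply, Pi.add_apply] at hm
      by_cases hva : a = v
      · subst hva
        have hne : b ≠ a := by rintro rfl; omega
        rw [delta_self, delta_of_ne hne] at hm
        have hm0 : m ≠ 0 := by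
          rintro rfl
          refine hv ?_
          rw [eCoeff, Finset.prod_eq_zero (mem_rowSet.2 hab), zero_div, neg_zero]
          rw [Nat.cast_zero] at hm
          linear_combination hm
        obtain ⟨k, rfl⟩ := Nat.exists_eq_succ_of_ne_zero hm0
        refine ⟨k, ?_⟩
        push_cast at hm
        linear_combination hm
      · rw [delta_of_ne hva] at hm
        by_cases hvb : b = v
        · subst hvb
          rw [delta_self] at hm
          refine ⟨m + 1, ?_⟩
          push_cast
          linear_combination hm
        · rw [delta_of_ne hvb] at hm
          exact ⟨m, by linear_combination hm⟩
    · rintro ⟨S, hS⟩ hSn v hv h ⟨m, hm⟩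
      simp only at hSn hv h hm
      refine hSn ?_
      change ∃ m : ℕ, S a - S b = (m : ℂ) + 1
      rw [Pi.sub_apply, Pi.sub_apply] at hm
      by_cases hvb : b = v
      · subst hvb
        have hne : a ≠ b := by rintro rfl; omega
        rw [delta_self, delta_of_ne hne] at hm
        have hm0 : m ≠ 0 := by
          rintro rfl
          refine hv ?_
          rw [fCoeff, Finset.prod_eq_zero (mem_rowBelow.2 hab.symm), zero_div]
          rw [Nat.cast_zero] at hm
          linear_combination -hm
        obtain ⟨k, rfl⟩ := Nat.exists_eq_succ_of_ne_zero hm0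
        refine ⟨k, ?_⟩
        push_cast at hm
        linear_combination hm
      · rw [delta_of_ne hvb] at hm
        by_cases hva : a = v
        · subst hva
          rw [delta_self] at hm
          refine ⟨m + 1, ?_⟩
          push_cast
          linear_combination hm
        · rw [delta_of_ne hva] at hm
          exact ⟨m, by linear_combination hm⟩
  · obtain ⟨m, hm⟩ := hr
    exact ⟨m, by rw [hLR.eq_of_top ha, hLR.eq_of_top hb, hm]⟩

end Module

end GT

theorem mainTheorem7 (n : ℕ) (hn : 2 ≤ n) (C : Set (GTRel n)) (hC : GT.NoncriticalSet C)
    (hadm : GT.Admissible C) (L : GTTableau n) (hL : GT.IsRealization C L)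
    [LieRingModule (Matrix (Fin n) (Fin n) ℂ) (GT.Space C L)]
    [LieModule ℂ (Matrix (Fin n) (Fin n) ℂ) (GT.Space C L)]
    (hGT : GT.IsGTModule C L) :
    LieModule.IsIrreducible ℂ (Matrix (Fin n) (Fin n) ℂ) (GT.Space C L) ↔
      GT.IsMaximalFor C L :=
  ⟨GT.isMaximalFor_of_isIrreducible hL hGT, GT.isIrreducible_of_isMaximalFor hadm hL hGT⟩
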